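/- Let $\nu>0$ and $r>0$. Let $S$ be a homogeneous Poisson process on $(0,\infty)$ with rate $\nu$ and epochs $t_1\le t_2\le\cdots$, and let $B_1,B_2,\ldots\ge 0$ be i.i.d. random variables, independent of $S$, with Laplace transform $\beta(\theta)=\mathbb E e^{-\theta B}$, where $B$ is distributed as $B_1$. Let $$\Lambda(t)=\sum_{i=1}^{S(t)}B_i\,e^{-r(t-t_i)},\qquad t\ge 0,$$ be the shot-noise process with exponential decay and $\Lambda(0)=0$. Consider the $M_{\rm S}/G/\infty$ queue, empty at time $0$: jobs arrive according to a Cox process with stochastic rate $\Lambda$ (that is, conditionally on the whole process $\Lambda$, the arrivals form an inhomogeneous Poisson process with rate function $\Lambda$), and the jobs have i.i.d. service requirements $J_1,J_2,\ldots\ge 0$, independent of $\Lambda$ and of the arrival process; $J$ denotes a random variable distributed as $J_1$. Let $N(t)$ be the number of jobs that have arrived by time $t$ and leave the system after time $t$. Then, for every $t\ge 0$: 1. Conditionally on $\Lambda$, the number of jobs $N(t)$ has a Poisson distribution with parameter $\int_0^t \mathbb P(J>t-u)\Lambda(u)\,du$. In particular, $N(t)$ has a mixed Poisson distribution with this random parameter.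 2. For real $z$ and $s$ put $\xi(t,z,s)=\mathbb E\, z^{N(t)}e^{-s\Lambda(t)}$ (with $0^0=1$). This expectation exists (the integrand is integrable) whenever $|z|\le 1$ and $s\ge 0$. 3. For all real $z,s$ for which this expectation exists, $\xi(t,z,s)>0$ and $$\log\xi(t,z,s)=\nu\int_0^t\left(\beta\left((1-z)e^{rv}\int_v^t\mathbb P(J>t-u)e^{-ru}\,du+s\,e^{-r(t-v)}\right)-1\right)dv,$$ where $\beta$ is finite at the indicated argument for almost every $v\in(0,t)$ and the integrand is integrable over $(0,t)$. -/

import Mathlib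

open MeasureTheory ProbabilityTheory Set Filter
open scoped NNReal ENNReal

namespace ShotNoiseQueue

variable {Ω : Type*}

/-- A counting process on `(0, ∞)`, started from `0`: `N t ω` is the number of points in `(0, t]`
(so it is `0` for `t ≤ 0`), and the paths are nondecreasing and right-continuous. -/
structure IsCountingProcess [MeasurableSpace Ω] (N : ℝ → Ω → ℕ) : Prop where
  measurable : ∀ t, Measurable (N t)
  eq_zero : ∀ t ≤ 0, ∀ ω, N t ω = 0
  mono : ∀ ω, Monotone fun t => N t ω
  rightCont : ∀ ω t, ContinuousWithinAt (fun u => N u ω) (Ici t) t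

/-- Homogeneous Poisson process with rate `ν`: independent increments, and `N t - N s` is Poisson
distributed with parameter `ν (t - s)` for `0 ≤ s ≤ t`. (The paths are nondecreasing, so the
natural-number subtraction is not truncated.) -/
structure IsPoissonProcess [MeasurableSpace Ω] (P : Measure Ω) (ν : ℝ) (N : ℝ → Ω → ℕ) : Prop
    extends IsCountingProcess N where
  hasLaw_increment : ∀ s t, 0 ≤ s → s ≤ t →
    HasLaw (fun ω => N t ω - N s ω) (poissonMeasure (ν * (t - s)).toNNReal) P
  indep_increments : HasIndepIncrements N P

/-- The epoch of the `(i + 1)`-th point of the counting process `N` (points are numbered from `0`):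
the first time at which more than `i` points have been counted. It is only used for `i < N t ω`
with some `t`, where the set below is nonempty and bounded below by `0`. -/
noncomputable def epoch (N : ℝ → Ω → ℕ) (i : ℕ) (ω : Ω) : ℝ :=
  sInf {u : ℝ | i < N u ω}

/-- Shot noise with exponential decay rate `r`, started from `0`: the `i`-th shot has size `B i` and
occurs at the `i`-th epoch of the counting process `S`. -/
noncomputable def shotNoise (r : ℝ) (S : ℝ → Ω → ℕ) (B : ℕ → Ω → ℝ) (t : ℝ) (ω : Ω) : ℝ :=
  ∑ i ∈ Finset.range (S t ω), B i ω * Real.exp (-r * (t - epoch S i ω))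

/-- The σ-algebra generated by a real-valued process. -/
@[reducible] def sigmaAlgebra (L : ℝ → Ω → ℝ) : MeasurableSpace Ω :=
  ⨆ t : ℝ, MeasurableSpace.comap (L t) inferInstance

/-- Cox process (doubly stochastic Poisson process) with stochastic rate `L`: conditionally on the
whole rate process `L`, it is an inhomogeneous Poisson process with rate function `L`, i.e. for
`0 ≤ τ 0 ≤ … ≤ τ n` the increments over the intervals `(τ i, τ (i + 1)]` are conditionally
independent and Poisson distributed with parameters `∫ u in τ i..τ (i + 1), L u`. -/
structure IsCoxProcess [MeasurableSpace Ω] (P : Measure Ω) (L : ℝ → Ω → ℝ) (A : ℝ → Ω → ℕ) : Prop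
    extends IsCountingProcess A where
  cond_increments : ∀ (n : ℕ) (τ : Fin (n + 1) → ℝ), Monotone τ → 0 ≤ τ 0 → ∀ k : Fin n → ℕ,
    P⟦{ω | ∀ i : Fin n, A (τ i.succ) ω - A (τ i.castSucc) ω = k i} | sigmaAlgebra L⟧ =ᵐ[P]
      fun ω => ∏ i : Fin n,
        (poissonMeasure (∫ u in (τ i.castSucc)..(τ i.succ), L u ω).toNNReal).real {k i}

/-- Number of jobs present at time `t` in the initially empty infinite-server queue with arrival
counting process `A`, in which the `i`-th arriving job has service requirement `J i`: the jobs that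
have arrived by time `t` and leave after time `t`. -/
noncomputable def numJobs (A : ℝ → Ω → ℕ) (J : ℕ → Ω → ℝ) (t : ℝ) (ω : Ω) : ℕ :=
  ((Finset.range (A t ω)).filter fun i => t < epoch A i ω + J i ω).card

/-- `β(θ) = E exp(-θ X)`. -/
noncomputable def laplace [MeasurableSpace Ω] (P : Measure Ω) (X : Ω → ℝ) (θ : ℝ) : ℝ :=
  ∫ ω, Real.exp (-θ * X ω) ∂P

/-- The function `v ↦ (1 - z) e^{r v} ∫_v^t P(X > t - u) e^{-r u} du + s e^{-r (t - v)}`. -/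
noncomputable def exponent [MeasurableSpace Ω] (P : Measure Ω) (X : Ω → ℝ) (r t z s v : ℝ) : ℝ :=
  (1 - z) * Real.exp (r * v) *
      (∫ u in v..t, P.real {ω | t - u < X ω} * Real.exp (-r * u)) +
    s * Real.exp (-r * (t - v))

/-- `ξ(t, z, s) = E z^{N(t)} e^{-s Λ(t)}`. -/
noncomputable def jointTransform [MeasurableSpace Ω] (P : Measure Ω) (N : ℝ → Ω → ℕ)
    (L : ℝ → Ω → ℝ) (t z s : ℝ) : ℝ :=
  ∫ ω, z ^ N t ω * Real.exp (-s * L t ω) ∂P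

end ShotNoiseQueue

namespace ShotNoiseQueue

/-! Everything rests on one product formula. If a point process with points `t_i` is Poisson given
its rate `λ`, then `E ∏ f(t_i) = E exp(∫_0^t (f - 1) λ)`, the product being over the points in `(0,
t]`. For `f` constant on the cells of a grid this is the generating function of independent Poisson
increments; bounded left-continuous `f` follow by dominated convergence
(`HasMixedPoissonIncrements.lintegral_prod_epoch`). The hypothesis `HasMixedPoissonIncrements`
covers both the shots (constant rate `ν`) and the Cox arrivals under `P` restricted to any event `F`
of the σ-algebra of `Λ`. Independent marks are averaged out beforehand by `lintegral_prod_epoch`.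

For the queue, a job arriving at `u` is present at `t` with probability `P(J > t - u)`, so averaging
over its service gives the factor `f(u) = 1 - (1 - z) P(J > t - u)`. Hence `E[z^N; F] = E[exp((z -
1) x); F]` with `x = ∫_0^t P(J > t - u) Λ(u) du`. Generating functions on `(0, 1]` determine the
law, so `N` is Poisson with parameter `x` given `Λ`.

Consequently `ξ = E exp((z - 1) x - s Λ(t))` wherever `ξ` exists. Both `x` and `Λ(t)` are linear in
the shots, so the exponent is `-∑ g(t_i) B_i` with `g` the function `exponent`, and the product
formula for the marked Poisson process gives `exp(ν ∫ (β(g) - 1))`. Since `g` may be negative,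
`β(g(v))` could be infinite; the factors are truncated at `M`, and monotone convergence shows that a
finite left side forces `β(g)` to be finite almost everywhere and integrable
(`IsPoissonProcess.laplaceFunctional`). -/

lemma IsCountingProcess.of_measurable {Ω : Type*} {mΩ : MeasurableSpace Ω} {N : ℝ → Ω → ℕ}
    (hN : IsCountingProcess N) (m : MeasurableSpace Ω) (hm : ∀ u, Measurable[m] (N u)) :
    IsCountingProcess N := by
  obtain ⟨-, h0, hmono, hc⟩ := hN
  exact ⟨hm, h0, hmono, hc⟩

/-! ### Epochs of a counting process -/

section Epoch

variable {Ω : Type*} {mΩ : MeasurableSpace Ω} {N : ℝ → Ω → ℕ} {i : ℕ} {t : ℝ} {ω : Ω}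

lemma IsCountingProcess.pos_of_lt (hN : IsCountingProcess N) {u : ℝ} (h : i < N u ω) : 0 < u := by
  by_contra! hu
  simp [hN.eq_zero u hu ω] at h

lemma IsCountingProcess.eventually_eq (hN : IsCountingProcess N) (ω : Ω) (u : ℝ) :
    ∀ᶠ v in nhdsWithin u (Ici u), N v ω = N u ω := by
  have h := hN.rightCont ω u
  rw [ContinuousWithinAt, nhds_discrete, tendsto_pure] at h
  exact h

/-- Right-continuity of an integer-valued path makes the infimum defining the epoch attained; `h`
makes the set nonempty. All order and measurability facts about epochs come from this equivalence.
-/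
lemma IsCountingProcess.epoch_le_iff (hN : IsCountingProcess N) (h : i < N t ω) (u : ℝ) :
    epoch N i ω ≤ u ↔ i < N u ω := by
  have hbdd : BddBelow {u : ℝ | i < N u ω} := ⟨0, fun u hu => (hN.pos_of_lt hu).le⟩
  constructor
  · intro hu
    refine lt_of_lt_of_le (b := N (epoch N i ω) ω) ?_ (hN.mono ω hu)
    have hev := hN.eventually_eq ω (epoch N i ω)
    rw [eventually_nhdsWithin_iff, Metric.eventually_nhds_iff] at hev
    obtain ⟨ε, hε, hev⟩ := hev
    -- A point of the set this close to its infimum lies where the path still has its value at the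
    -- infimum.
    obtain ⟨e, he, hlt⟩ := Real.lt_sInf_add_pos (s := {u : ℝ | i < N u ω}) ⟨t, h⟩ hε
    have hge : epoch N i ω ≤ e := csInf_le hbdd he
    have : N e ω = N (epoch N i ω) ω := by
      refine hev ?_ hge
      rw [Real.dist_eq, abs_of_nonneg (sub_nonneg.2 hge)]
      simp only [epoch]
      linarith
    rw [← this]
    exact he
  · intro hu
    exact csInf_le hbdd hu

lemma IsCountingProcess.epoch_pos (hN : IsCountingProcess N) (h : i < N t ω) :
    0 < epoch N i ω :=
  hN.pos_of_lt ((hN.epoch_le_iff h _).1 le_rfl)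

lemma IsCountingProcess.epoch_le (hN : IsCountingProcess N) (h : i < N t ω) :
    epoch N i ω ≤ t :=
  (hN.epoch_le_iff h _).2 h

/-- The epoch of a point counted by time `t`, and `0` for the later points. -/
noncomputable def truncEpoch (N : ℝ → Ω → ℕ) (t : ℝ) (i : ℕ) (ω : Ω) : ℝ :=
  if i < N t ω then epoch N i ω else 0

lemma truncEpoch_of_lt (h : i < N t ω) : truncEpoch N t i ω = epoch N i ω := if_pos h

lemma IsCountingProcess.measurable_truncEpoch (hN : IsCountingProcess N) (t : ℝ) (i : ℕ) :
    Measurable (truncEpoch N t i) := by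
  refine measurable_of_Iic fun u => ?_
  have hlt : ∀ v, MeasurableSet {ω | i < N v ω} := fun v =>
    hN.measurable v (measurableSet_Ioi (a := i))
  have heq : truncEpoch N t i ⁻¹' Iic u =
      ({ω | i < N t ω} ∩ {ω | i < N u ω}) ∪ ({ω | i < N t ω}ᶜ ∩ {_ω | 0 ≤ u}) := by
    ext ω
    by_cases h : i < N t ω
    · simp [truncEpoch, h, hN.epoch_le_iff h]
    · simp [truncEpoch, h]
  rw [heq]
  exact ((hlt t).inter (hlt u)).union ((hlt t).compl.inter (MeasurableSet.const _))

/-- Only indices below `N t ω` occur, so the epochs may be replaced by their truncations, which are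
known to be random variables. -/
lemma prod_range_epoch {M : Type*} [CommMonoid M] (f : ℕ → ℝ → M) (t : ℝ) (ω : Ω) :
    ∏ i ∈ Finset.range (N t ω), f i (epoch N i ω) =
      ∏ i ∈ Finset.range (N t ω), f i (truncEpoch N t i ω) :=
  Finset.prod_congr rfl fun i hi => by rw [truncEpoch_of_lt (Finset.mem_range.1 hi)]

lemma sum_range_epoch {M : Type*} [AddCommMonoid M] (f : ℕ → ℝ → M) (t : ℝ) (ω : Ω) :
    ∑ i ∈ Finset.range (N t ω), f i (epoch N i ω) =
      ∑ i ∈ Finset.range (N t ω), f i (truncEpoch N t i ω) :=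
  Finset.sum_congr rfl fun i hi => by rw [truncEpoch_of_lt (Finset.mem_range.1 hi)]

end Epoch

/-! ### Measurability and path properties of the shot noise and the queue -/

section Measurability

variable {Ω : Type*} {mΩ : MeasurableSpace Ω}

lemma measurable_prod_range {M : Type*} [CommMonoid M] [MeasurableSpace M] [MeasurableMul₂ M]
    {K : Ω → ℕ} (hK : Measurable K) {f : ℕ → Ω → M} (hf : ∀ i, Measurable (f i)) :
    Measurable fun ω => ∏ i ∈ Finset.range (K ω), f i ω := by
  have : Measurable fun p : Ω × ℕ => ∏ i ∈ Finset.range p.2, f i p.1 :=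
    measurable_from_prod_countable_left fun n =>
      Finset.measurable_fun_prod (Finset.range n) fun i _ => hf i
  exact this.comp (measurable_id.prodMk hK)

lemma measurable_sum_range {M : Type*} [AddCommMonoid M] [MeasurableSpace M] [MeasurableAdd₂ M]
    {K : Ω → ℕ} (hK : Measurable K) {f : ℕ → Ω → M} (hf : ∀ i, Measurable (f i)) :
    Measurable fun ω => ∑ i ∈ Finset.range (K ω), f i ω := by
  have : Measurable fun p : Ω × ℕ => ∑ i ∈ Finset.range p.2, f i p.1 :=
    measurable_from_prod_countable_left fun n =>
      Finset.measurable_fun_sum (Finset.range n) fun i _ => hf i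
  exact this.comp (measurable_id.prodMk hK)

lemma measurable_shotNoise {r : ℝ} {S : ℝ → Ω → ℕ} (hS : IsCountingProcess S) {B : ℕ → Ω → ℝ}
    (hB : ∀ i, Measurable (B i)) (t : ℝ) : Measurable (shotNoise r S B t) := by
  have heq : shotNoise r S B t = fun ω => ∑ i ∈ Finset.range (S t ω),
      B i ω * Real.exp (-r * (t - truncEpoch S t i ω)) :=
    funext fun ω => sum_range_epoch (fun i e => B i ω * Real.exp (-r * (t - e))) t ω
  rw [heq]
  refine measurable_sum_range (hS.measurable t) fun i => ?_
  have := hS.measurable_truncEpoch t i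
  have := hB i
  fun_prop

lemma numJobs_eq_sum (A : ℝ → Ω → ℕ) (J : ℕ → Ω → ℝ) (t : ℝ) (ω : Ω) :
    numJobs A J t ω =
      ∑ i ∈ Finset.range (A t ω), if t < epoch A i ω + J i ω then 1 else 0 :=
  Finset.card_filter _ _

lemma measurable_numJobs {A : ℝ → Ω → ℕ} (hA : IsCountingProcess A) {J : ℕ → Ω → ℝ}
    (hJ : ∀ i, Measurable (J i)) (t : ℝ) : Measurable (numJobs A J t) := by
  have heq : numJobs A J t = fun ω => ∑ i ∈ Finset.range (A t ω),
      if t < truncEpoch A t i ω + J i ω then 1 else 0 := funext fun ω => by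
    rw [numJobs_eq_sum]
    exact sum_range_epoch (fun i e => if t < e + J i ω then 1 else 0) t ω
  rw [heq]
  refine measurable_sum_range (hA.measurable t) fun i => ?_
  have := hA.measurable_truncEpoch t i
  have := hJ i
  exact Measurable.ite (measurableSet_lt (by fun_prop) (by fun_prop)) measurable_const
    measurable_const

/-- A process with right-continuous paths is jointly measurable. -/
lemma measurable_uncurry_of_rightCont {L : ℝ → Ω → ℝ} (hL : ∀ u, Measurable (L u))
    (hcont : ∀ ω u, ContinuousWithinAt (fun v => L v ω) (Ici u) u) :
    Measurable fun p : ℝ × Ω => L p.1 p.2 := by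
  -- The grid point just to the right of `u` takes countably many values, so the process evaluated
  -- there is jointly measurable; right-continuity passes this to the limit.
  have hgrid : ∀ u : ℝ, Tendsto (fun n : ℕ => ((⌊u * (n + 1)⌋ : ℝ) + 1) / ((n : ℝ) + 1)) atTop
      (nhdsWithin u (Ici u)) := by
    intro u
    have hge : ∀ n : ℕ, u ≤ ((⌊u * (n + 1)⌋ : ℝ) + 1) / ((n : ℝ) + 1) := fun n => by
      rw [le_div_iff₀ (by positivity)]
      exact (Int.lt_floor_add_one _).le
    refine tendsto_nhdsWithin_iff.2 ⟨?_, Eventually.of_forall hge⟩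
    have hup : Tendsto (fun n : ℕ => u + 1 / ((n : ℝ) + 1)) atTop (nhds u) := by
      simpa using tendsto_const_nhds.add (tendsto_one_div_add_atTop_nhds_zero_nat (𝕜 := ℝ))
    refine tendsto_of_tendsto_of_tendsto_of_le_of_le tendsto_const_nhds hup hge fun n => ?_
    have hn : (0 : ℝ) < (n : ℝ) + 1 := by positivity
    simp only
    rw [div_le_iff₀ hn, add_mul, one_div, inv_mul_cancel₀ hn.ne']
    linarith [Int.floor_le (u * ((n : ℝ) + 1))]
  refine measurable_of_tendsto_metrizable
    (f := fun (n : ℕ) (p : ℝ × Ω) => L (((⌊p.1 * (n + 1)⌋ : ℝ) + 1) / ((n : ℝ) + 1)) p.2)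
    (fun n => ?_) (tendsto_pi_nhds.2 fun p => (hcont p.2 p.1).tendsto.comp (hgrid p.1))
  have h1 : Measurable fun q : ℤ × Ω => L (((q.1 : ℝ) + 1) / ((n : ℝ) + 1)) q.2 :=
    measurable_from_prod_countable_right fun k => hL (((k : ℝ) + 1) / ((n : ℝ) + 1))
  have h2 : Measurable fun p : ℝ × Ω => ((⌊p.1 * (n + 1)⌋, p.2) : ℤ × Ω) :=
    (Int.measurable_floor.comp (measurable_fst.mul_const _)).prodMk measurable_snd
  exact h1.comp h2

lemma shotNoise_rightCont {r : ℝ} {S : ℝ → Ω → ℕ} (hS : IsCountingProcess S) (B : ℕ → Ω → ℝ)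
    (ω : Ω) (u : ℝ) : ContinuousWithinAt (fun v => shotNoise r S B v ω) (Ici u) u := by
  have hev := hS.eventually_eq ω u
  have hc : Continuous fun v : ℝ => ∑ i ∈ Finset.range (S u ω),
      B i ω * Real.exp (-r * (v - epoch S i ω)) := by fun_prop
  refine hc.continuousWithinAt.congr_of_eventuallyEq ?_ rfl
  filter_upwards [hev] with v hv
  simp only [shotNoise, hv]

lemma shotNoise_nonneg {r : ℝ} {S : ℝ → Ω → ℕ} {B : ℕ → Ω → ℝ} (hB : ∀ i ω, 0 ≤ B i ω) (u : ℝ)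
    (ω : Ω) : 0 ≤ shotNoise r S B u ω :=
  Finset.sum_nonneg fun i _ => mul_nonneg (hB i ω) (Real.exp_nonneg _)

/-- Gives all times `u ≤ t` the common index set of shots up to `t`, so that integration over `u`
can be exchanged with the sum. -/
lemma shotNoise_eq_sum_indicator {r : ℝ} {S : ℝ → Ω → ℕ} (hS : IsCountingProcess S)
    (B : ℕ → Ω → ℝ) {u t : ℝ} (hut : u ≤ t) (ω : Ω) :
    shotNoise r S B u ω = ∑ i ∈ Finset.range (S t ω),
      (Ici (epoch S i ω)).indicator (fun u => B i ω * Real.exp (-r * (u - epoch S i ω))) u := by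
  have hsub : Finset.range (S u ω) ⊆ Finset.range (S t ω) :=
    Finset.range_subset_range.2 (hS.mono ω hut)
  rw [shotNoise, ← Finset.sum_subset hsub]
  · refine Finset.sum_congr rfl fun i hi => ?_
    rw [indicator_of_mem]
    exact hS.epoch_le (Finset.mem_range.1 hi)
  · intro i hi hi'
    rw [indicator_of_notMem]
    rw [mem_Ici, hS.epoch_le_iff (Finset.mem_range.1 hi)]
    simpa using hi'

lemma shotNoise_le {r : ℝ} (hr : 0 ≤ r) {S : ℝ → Ω → ℕ} (hS : IsCountingProcess S)
    {B : ℕ → Ω → ℝ} (hB : ∀ i ω, 0 ≤ B i ω) {u t : ℝ} (hut : u ≤ t) (ω : Ω) :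
    shotNoise r S B u ω ≤ ∑ i ∈ Finset.range (S t ω), B i ω := by
  rw [shotNoise_eq_sum_indicator hS B hut]
  refine Finset.sum_le_sum fun i _ => indicator_apply_le' (fun h => ?_) fun _ => hB i ω
  refine mul_le_of_le_one_right (hB i ω) (Real.exp_le_one_iff.2 ?_)
  have : epoch S i ω ≤ u := h
  nlinarith

end Measurability

/-! ### Integrating out independent marks -/

section Mixing

variable {Ω : Type*}

/-- Marks that are i.i.d. and independent of the points can be integrated out one by one. -/
lemma lintegral_prod_epoch {m mΩ : MeasurableSpace Ω} (hm : m ≤ mΩ) {P : Measure Ω}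
    [IsProbabilityMeasure P] {N : ℝ → Ω → ℕ} (hN : IsCountingProcess N) {X : ℕ → Ω → ℝ}
    (hX : ∀ i, Measurable (X i)) (hindep : iIndepFun X P)
    (hident : ∀ i, IdentDistrib (X i) (X 0) P P) (hNm : ∀ u, Measurable[m] (N u))
    (hXm : Indep (MeasurableSpace.comap (fun ω i => X i ω) inferInstance) m P)
    {φ : ℝ × ℝ → ℝ≥0∞} (hφ : Measurable φ) {F : Set Ω} (hF : MeasurableSet[m] F) (t : ℝ) :
    ∫⁻ ω in F, ∏ i ∈ Finset.range (N t ω), φ (X i ω, epoch N i ω) ∂P =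
      ∫⁻ ω in F, ∏ i ∈ Finset.range (N t ω), (∫⁻ ω', φ (X 0 ω', epoch N i ω) ∂P) ∂P := by
  let Y : Ω → ℕ → ℝ := fun ω i => X i ω
  -- `V` collects all the `m`-measurable data in the integrand, including the indicator of `F`. It
  -- is independent of the marks `Y`, so the joint law is a product and Tonelli applies.
  let V : Ω → (ℕ × (ℕ → ℝ)) × ℝ≥0∞ := fun ω =>
    ((N t ω, fun i => truncEpoch N t i ω), F.indicator 1 ω)
  have hY : Measurable Y := measurable_pi_lambda _ hX
  have hVm : Measurable[m] V := by
    -- Epochs must be measurable for `m` itself, so the counting-process structure is carried over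
    -- to `m`.
    have hNm' := hN.of_measurable m hNm
    refine Measurable.prodMk (Measurable.prodMk (hNm t) ?_) ?_
    · exact @measurable_pi_lambda _ _ _ m _ _ fun i => hNm'.measurable_truncEpoch t i
    · exact Measurable.indicator (m := m) (@measurable_const _ _ _ m 1) hF
  have hV : Measurable V := hVm.mono hm le_rfl
  have hYV : IndepFun Y V P := by
    rw [IndepFun_iff_Indep]
    exact indep_of_indep_of_le_right hXm hVm.comap_le
  have hprod := (indepFun_iff_map_prod_eq_prod_map_map hY.aemeasurable hV.aemeasurable).1 hYV
  let G : (ℕ → ℝ) × ((ℕ × (ℕ → ℝ)) × ℝ≥0∞) → ℝ≥0∞ := fun p =>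
    p.2.2 * ∏ i ∈ Finset.range p.2.1.1, φ (p.1 i, p.2.1.2 i)
  have hG : Measurable G := by
    refine (measurable_snd.comp measurable_snd).mul
      (measurable_prod_range (by fun_prop) fun i => hφ.comp ?_)
    fun_prop
  have hFm := hm _ hF
  have hleft : ∫⁻ ω in F, ∏ i ∈ Finset.range (N t ω), φ (X i ω, epoch N i ω) ∂P =
      ∫⁻ ω, G (Y ω, V ω) ∂P := by
    rw [← lintegral_indicator hFm]
    refine lintegral_congr fun ω => ?_
    by_cases h : ω ∈ F
    · simpa [G, V, Y, h] using prod_range_epoch (fun i e => φ (X i ω, e)) t ω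
    · simp [G, V, h]
  have hinner : ∀ v : (ℕ × (ℕ → ℝ)) × ℝ≥0∞, ∫⁻ ω', G (Y ω', v) ∂P =
      v.2 * ∏ i ∈ Finset.range v.1.1, ∫⁻ ω', φ (X 0 ω', v.1.2 i) ∂P := by
    intro v
    have hmeas : ∀ i, Measurable fun x => φ (x, v.1.2 i) := fun i => hφ.comp (by fun_prop)
    have hmeas' : ∀ i, Measurable fun ω => φ (X i ω, v.1.2 i) := fun i => (hmeas i).comp (hX i)
    simp only [G, Y]
    rw [lintegral_const_mul _ (Finset.measurable_fun_prod _ fun i _ => hmeas' i),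
      lintegral_prod_eq_prod_lintegral_of_indepFun (Finset.range v.1.1)
        (fun i ω => φ (X i ω, v.1.2 i)) (hindep.comp _ hmeas) hmeas']
    congr 1
    refine Finset.prod_congr rfl fun i _ => ?_
    exact ((hident i).comp (hmeas i)).lintegral_eq
  rw [hleft, ← lintegral_map (f := G) hG (hY.prodMk hV), hprod, lintegral_prod_symm' _ hG,
    lintegral_map hG.lintegral_prod_left hV, ← lintegral_indicator hFm]
  refine lintegral_congr fun ω => ?_
  rw [lintegral_map (f := fun x => G (x, V ω)) (by fun_prop) hY, hinner]
  by_cases h : ω ∈ F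
  · simpa [V, h] using (prod_range_epoch (fun _ e => ∫⁻ ω', φ (X 0 ω', e) ∂P) t ω).symm
  · simp [V, h]

end Mixing

/-! ### Generating function of the Poisson law -/

section PoissonTransform

lemma lintegral_pow_poissonMeasure (p : ℝ≥0) {x : ℝ} (hx : 0 ≤ x) :
    ∫⁻ n, ENNReal.ofReal x ^ n ∂poissonMeasure p = ENNReal.ofReal (Real.exp ((x - 1) * p)) := by
  have hs : HasSum (fun n : ℕ => x ^ n * (Real.exp (-p) * (p : ℝ) ^ n / n.factorial))
      (Real.exp ((x - 1) * p)) := by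
    have h := (NormedSpace.expSeries_div_hasSum_exp (x * p : ℝ)).mul_left (Real.exp (-p))
    rw [← Real.exp_eq_exp_ℝ, ← Real.exp_add] at h
    convert! h using 1
    · ext n
      rw [mul_pow]
      ring
    · congr 1
      ring
  rw [lintegral_countable', ← hs.tsum_eq,
    ENNReal.ofReal_tsum_of_nonneg (fun n => by positivity) hs.summable]
  refine tsum_congr fun n => ?_
  rw [poissonMeasure_singleton, ← ENNReal.ofReal_pow hx, ← ENNReal.ofReal_mul (by positivity)]

lemma measurable_intervalIntegral {Ω : Type*} {mΩ : MeasurableSpace Ω} {f : ℝ → Ω → ℝ}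
    (hf : Measurable fun p : ℝ × Ω => f p.1 p.2) (a b : ℝ) :
    Measurable fun ω => ∫ u in a..b, f u ω := by
  have h : ∀ s : Set ℝ, Measurable fun ω => ∫ u in s, f u ω := fun s =>
    (hf.stronglyMeasurable.integral_prod_left (μ := volume.restrict s)).measurable
  exact (h _).sub (h _)

end PoissonTransform

/-! ### Generating functional of a mixed Poisson process -/

section DrivenProcess

variable {Ω : Type*} {mΩ : MeasurableSpace Ω} {μ : Measure Ω} {lam : ℝ → Ω → ℝ} {A : ℝ → Ω → ℕ}

/-- The increments of `A` are distributed as a mixture, under `μ`, of those of inhomogeneous Poisson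
processes with rate functions `lam · ω`. -/
def HasMixedPoissonIncrements (μ : Measure Ω) (lam : ℝ → Ω → ℝ) (A : ℝ → Ω → ℕ) : Prop :=
  ∀ (n : ℕ) (τ : Fin (n + 1) → ℝ), Monotone τ → 0 ≤ τ 0 → ∀ k : Fin n → ℕ,
    μ {ω | ∀ i : Fin n, A (τ i.succ) ω - A (τ i.castSucc) ω = k i} =
      ∫⁻ ω, ∏ i : Fin n,
        poissonMeasure (∫ u in (τ i.castSucc)..(τ i.succ), lam u ω).toNNReal {k i} ∂μ

lemma measurable_poissonMeasure_singleton {f : Ω → ℝ} (hf : Measurable f) (k : ℕ) :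
    Measurable fun ω => poissonMeasure (f ω).toNNReal {k} := by
  simp_rw [poissonMeasure_singleton]
  fun_prop

/-- Sum over the values of the increment vector and exchange sum and integral: for a fixed rate path
the increments have a product Poisson law, whose generating function factorises. -/
lemma HasMixedPoissonIncrements.lintegral_prod_pow (h : HasMixedPoissonIncrements μ lam A)
    (hA : IsCountingProcess A) (hlam : Measurable fun p : ℝ × Ω => lam p.1 p.2)
    (hlam0 : ∀ u ω, 0 ≤ lam u ω) {n : ℕ} {τ : Fin (n + 1) → ℝ} (hτ : Monotone τ) (hτ0 : 0 ≤ τ 0)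
    {x : Fin n → ℝ} (hx : ∀ i, 0 ≤ x i) :
    ∫⁻ ω, ∏ i, ENNReal.ofReal (x i) ^ (A (τ i.succ) ω - A (τ i.castSucc) ω) ∂μ =
      ∫⁻ ω, ENNReal.ofReal (Real.exp
        (∑ i, (x i - 1) * ∫ u in (τ i.castSucc)..(τ i.succ), lam u ω)) ∂μ := by
  let a : Ω → Fin n → ℕ := fun ω i => A (τ i.succ) ω - A (τ i.castSucc) ω
  have hsub : Measurable fun p : ℕ × ℕ => p.1 - p.2 := .of_discrete
  have ha : Measurable a := measurable_pi_lambda _ fun i =>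
    hsub.comp ((hA.measurable (τ i.succ)).prodMk (hA.measurable (τ i.castSucc)))
  let G : (Fin n → ℕ) → ℝ≥0∞ := fun k => ∏ i, ENNReal.ofReal (x i) ^ k i
  have hG : Measurable G := .of_discrete
  have hint : ∀ i : Fin n, Measurable fun ω => ∫ u in (τ i.castSucc)..(τ i.succ), lam u ω :=
    fun i => measurable_intervalIntegral hlam _ _
  have hsingle : ∀ k, μ.map a {k} = ∫⁻ ω, ∏ i : Fin n,
      poissonMeasure (∫ u in (τ i.castSucc)..(τ i.succ), lam u ω).toNNReal {k i} ∂μ := by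
    intro k
    rw [Measure.map_apply ha (measurableSet_singleton k), ← h n τ hτ hτ0 k]
    congr 1
    ext ω
    simp [a, funext_iff]
  have hpi : ∀ p : Fin n → ℝ≥0, ∑' k : Fin n → ℕ, G k * ∏ i, poissonMeasure (p i) {k i} =
      ENNReal.ofReal (Real.exp (∑ i, (x i - 1) * p i)) := by
    intro p
    have h1 : ∑' k : Fin n → ℕ, G k * ∏ i, poissonMeasure (p i) {k i} =
        ∫⁻ k, G k ∂Measure.pi fun i => poissonMeasure (p i) := by
      rw [lintegral_countable']
      refine tsum_congr fun k => ?_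
      rw [Measure.pi_singleton]
    rw [h1, lintegral_prod_eq_prod_lintegral_of_indepFun Finset.univ
      (fun i (k : Fin n → ℕ) => ENNReal.ofReal (x i) ^ k i)
      (iIndepFun_pi (X := fun i (k : ℕ) => ENNReal.ofReal (x i) ^ k)
        fun i => measurable_from_top.aemeasurable)
      (fun i => measurable_from_top.comp (measurable_pi_apply i)), Real.exp_sum,
      ENNReal.ofReal_prod_of_nonneg fun i _ => Real.exp_nonneg _]
    refine Finset.prod_congr rfl fun i _ => ?_
    rw [← lintegral_pow_poissonMeasure _ (hx i)]
    exact (measurePreserving_eval (fun i => poissonMeasure (p i)) i).lintegral_comp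
      (f := fun k : ℕ => ENNReal.ofReal (x i) ^ k) measurable_from_top
  calc ∫⁻ ω, ∏ i, ENNReal.ofReal (x i) ^ (A (τ i.succ) ω - A (τ i.castSucc) ω) ∂μ
      = ∫⁻ k, G k ∂μ.map a := (lintegral_map hG ha).symm
    _ = ∑' k, G k * ∫⁻ ω, ∏ i : Fin n,
          poissonMeasure (∫ u in (τ i.castSucc)..(τ i.succ), lam u ω).toNNReal {k i} ∂μ := by
        rw [lintegral_countable']
        exact tsum_congr fun k => by rw [hsingle]
    _ = ∫⁻ ω, ∑' k, G k * ∏ i : Fin n,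
          poissonMeasure (∫ u in (τ i.castSucc)..(τ i.succ), lam u ω).toNNReal {k i} ∂μ := by
        have hm : ∀ k : Fin n → ℕ, Measurable fun ω => ∏ i : Fin n,
            poissonMeasure (∫ u in (τ i.castSucc)..(τ i.succ), lam u ω).toNNReal {k i} :=
          fun k => Finset.measurable_fun_prod _ fun i _ =>
            measurable_poissonMeasure_singleton (hint i) _
        rw [lintegral_tsum fun k => ((hm k).const_mul _).aemeasurable]
        exact tsum_congr fun k => (lintegral_const_mul _ (hm k)).symm
    _ = _ := by
        refine lintegral_congr fun ω => ?_
        rw [hpi]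
        congr 2
        refine Finset.sum_congr rfl fun i _ => ?_
        rw [Real.coe_toNNReal]
        exact intervalIntegral.integral_nonneg (hτ (Fin.castSucc_lt_succ (i := i)).le)
          fun u _ => hlam0 u ω

/-- The points numbered from `A (τ k)` up to, but excluding, `A (τ (k + 1))` are exactly those in
the cell `(τ k, τ (k + 1)]`, and each contributes the factor `x k`. -/
lemma IsCountingProcess.prod_range_eq_prod_pow (hA : IsCountingProcess A) {M : Type*}
    [CommMonoid M] {τ : ℕ → ℝ} (hτ : Monotone τ) (hτ0 : τ 0 = 0) {f : ℝ → M} {x : ℕ → M}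
    (hf : ∀ k, ∀ u ∈ Ioc (τ k) (τ (k + 1)), f u = x k) (ω : Ω) (n : ℕ) :
    ∏ i ∈ Finset.range (A (τ n) ω), f (epoch A i ω) =
      ∏ k ∈ Finset.range n, x k ^ (A (τ (k + 1)) ω - A (τ k) ω) := by
  induction n with
  | zero => simp [hτ0, hA.eq_zero 0 le_rfl]
  | succ n ih =>
    have hle : A (τ n) ω ≤ A (τ (n + 1)) ω := hA.mono ω (hτ n.le_succ)
    rw [Finset.prod_range_succ, ← ih, ← Finset.prod_range_mul_prod_Ico _ hle]
    congr 1
    rw [← Nat.card_Ico, ← Finset.prod_const]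
    refine Finset.prod_congr rfl fun i hi => hf n _ ?_
    rw [Finset.mem_Ico] at hi
    refine ⟨?_, hA.epoch_le hi.2⟩
    rw [← not_le, hA.epoch_le_iff hi.2]
    exact not_lt.2 hi.1

/-- The left end point of the cell `(k t / (n + 1), (k + 1) t / (n + 1)]` that contains `u`. -/
noncomputable def gridLeft (t : ℝ) (n : ℕ) (u : ℝ) : ℝ :=
  ((⌈u * (n + 1) / t⌉ : ℝ) - 1) * t / (n + 1)

lemma gridLeft_eq {t : ℝ} (ht : 0 < t) (n k : ℕ) {u : ℝ}
    (hu : u ∈ Ioc ((k : ℝ) * t / (n + 1)) (((k + 1 : ℕ) : ℝ) * t / (n + 1))) :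
    gridLeft t n u = (k : ℝ) * t / (n + 1) := by
  have hn : (0 : ℝ) < (n : ℝ) + 1 := by positivity
  have hc : ⌈u * (n + 1) / t⌉ = (k : ℤ) + 1 := by
    rw [Int.ceil_eq_iff]
    have h1 := (div_lt_iff₀ hn).1 hu.1
    have h2 := (le_div_iff₀ hn).1 hu.2
    push_cast at h2 ⊢
    constructor
    · rw [lt_div_iff₀ ht]
      linarith
    · rw [div_le_iff₀ ht]
      linarith
  rw [gridLeft, hc]
  push_cast
  ring

/-- The left end point is at most `u` and at least `u - t / (n + 1)`. Approach from the left is why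
left-continuity of `f` suffices later. -/
lemma tendsto_gridLeft {t : ℝ} (ht : 0 < t) (u : ℝ) :
    Tendsto (fun n => gridLeft t n u) atTop (nhdsWithin u (Iic u)) := by
  have hle : ∀ n, gridLeft t n u ≤ u := fun n => by
    have hn : (0 : ℝ) < (n : ℝ) + 1 := by positivity
    rw [gridLeft, div_le_iff₀ hn, ← le_div_iff₀ ht]
    linarith [Int.ceil_lt_add_one (u * (n + 1) / t)]
  refine tendsto_nhdsWithin_iff.2 ⟨?_, Eventually.of_forall hle⟩
  have hlow : Tendsto (fun n : ℕ => u - t * (1 / ((n : ℝ) + 1))) atTop (nhds u) := by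
    simpa using tendsto_const_nhds.sub
      ((tendsto_one_div_add_atTop_nhds_zero_nat (𝕜 := ℝ)).const_mul t)
  refine tendsto_of_tendsto_of_tendsto_of_le_of_le hlow tendsto_const_nhds (fun n => ?_) hle
  have hn : (0 : ℝ) < (n : ℝ) + 1 := by positivity
  have h1 := (div_le_iff₀ ht).1 (Int.le_ceil (u * (n + 1) / t))
  simp only [gridLeft]
  rw [le_div_iff₀ hn]
  have : (u - t * (1 / ((n : ℝ) + 1))) * (n + 1) = u * (n + 1) - t := by
    field_simp
  linarith

lemma measurable_comp_gridLeft {α : Type*} [MeasurableSpace α] (h : ℝ → α) (t : ℝ) (n : ℕ) :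
    Measurable fun u => h (gridLeft t n u) :=
  (measurable_from_top (f := fun c : ℤ => h (((c : ℝ) - 1) * t / (n + 1)))).comp
    (Int.measurable_ceil.comp (by fun_prop : Measurable fun u : ℝ => u * (n + 1) / t))

lemma HasMixedPoissonIncrements.lintegral_prod_gridLeft (h : HasMixedPoissonIncrements μ lam A)
    (hA : IsCountingProcess A) (hlam : Measurable fun p : ℝ × Ω => lam p.1 p.2)
    (hlam0 : ∀ u ω, 0 ≤ lam u ω) {t : ℝ} (ht : 0 < t)
    (hint : ∀ ω, IntervalIntegrable (fun u => lam u ω) volume 0 t) {f : ℝ → ℝ}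
    (hf : ∀ u, 0 ≤ f u) (n : ℕ) :
    ∫⁻ ω, ∏ i ∈ Finset.range (A t ω), ENNReal.ofReal (f (gridLeft t n (epoch A i ω))) ∂μ =
      ∫⁻ ω, ENNReal.ofReal (Real.exp (∫ u in (0 : ℝ)..t, (f (gridLeft t n u) - 1) * lam u ω)) ∂μ
      := by
  have hn : (0 : ℝ) < (n : ℝ) + 1 := by positivity
  let τ : ℕ → ℝ := fun k => (k : ℝ) * t / (n + 1)
  have hτ : Monotone τ := fun a b hab => by
    have : (a : ℝ) ≤ b := by exact_mod_cast hab
    simp only [τ]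
    gcongr
  have hτ0 : τ 0 = 0 := by simp [τ]
  have hτn : τ (n + 1) = t := by
    simp only [τ]
    push_cast
    field_simp
  have hcell : ∀ k, ∀ u ∈ Ioc (τ k) (τ (k + 1)), gridLeft t n u = τ k :=
    fun k u hu => gridLeft_eq ht n k hu
  have hpgf := h.lintegral_prod_pow hA hlam hlam0 (n := n + 1) (τ := fun i => τ i)
    (fun i j hij => hτ hij) (by simp [hτ0]) (x := fun i => f (τ i)) (fun i => hf _)
  simp only [Fin.val_succ, Fin.val_castSucc] at hpgf
  calc _ = ∫⁻ ω, ∏ i : Fin (n + 1),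
          ENNReal.ofReal (f (τ i)) ^ (A (τ (i + 1)) ω - A (τ i) ω) ∂μ := by
        refine lintegral_congr fun ω => ?_
        rw [Fin.prod_univ_eq_prod_range
          (fun k => ENNReal.ofReal (f (τ k)) ^ (A (τ (k + 1)) ω - A (τ k) ω)) (n + 1),
          ← hA.prod_range_eq_prod_pow hτ hτ0 (f := fun u => ENNReal.ofReal (f (gridLeft t n u)))
            (fun k u hu => by rw [hcell k u hu]), hτn]
    _ = _ := hpgf
    _ = _ := by
        refine lintegral_congr fun ω => ?_
        congr 2
        rw [Fin.sum_univ_eq_sum_range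
          (fun k => (f (τ k) - 1) * ∫ u in (τ k)..(τ (k + 1)), lam u ω) (n + 1)]
        have hpiece : ∀ k, Set.EqOn (fun u => (f (gridLeft t n u) - 1) * lam u ω)
            (fun u => (f (τ k) - 1) * lam u ω) (uIoc (τ k) (τ (k + 1))) := fun k u hu => by
          rw [uIoc_of_le (hτ k.le_succ)] at hu
          simp only [hcell k u hu]
        have hlk : ∀ k < n + 1, IntervalIntegrable (fun u => lam u ω) volume (τ k) (τ (k + 1)) := by
          intro k hk
          refine (hint ω).mono_set ?_
          rw [uIcc_of_le (hτ k.le_succ), uIcc_of_le ht.le]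
          exact Icc_subset_Icc (hτ0 ▸ hτ k.zero_le) (hτn ▸ hτ (Nat.succ_le_of_lt hk))
        have hsum := intervalIntegral.sum_integral_adjacent_intervals (n := n + 1) (a := τ)
          (f := fun u => (f (gridLeft t n u) - 1) * lam u ω) (μ := volume) fun k hk =>
            ((hlk k hk).const_mul (f (τ k) - 1)).congr (hpiece k).symm
        rw [hτ0, hτn] at hsum
        rw [← hsum]
        refine Finset.sum_congr rfl fun k _ => ?_
        rw [← intervalIntegral.integral_const_mul]
        exact (intervalIntegral.integral_congr_ae (Eventually.of_forall (hpiece k))).symm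

/-- The probability generating functional of a mixed Poisson process. -/
lemma HasMixedPoissonIncrements.lintegral_prod_epoch (h : HasMixedPoissonIncrements μ lam A)
    (hA : IsCountingProcess A) (hlam : Measurable fun p : ℝ × Ω => lam p.1 p.2)
    (hlam0 : ∀ u ω, 0 ≤ lam u ω) {t : ℝ} (ht : 0 ≤ t)
    (hint : ∀ ω, IntervalIntegrable (fun u => lam u ω) volume 0 t) {M : ℝ}
    (hM : ∫⁻ ω, ENNReal.ofReal (Real.exp ((M - 1) * ∫ u in (0 : ℝ)..t, lam u ω)) ∂μ ≠ ∞)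
    {f : ℝ → ℝ} (hf : ∀ u, 0 ≤ f u) (hfM : ∀ u, f u ≤ M)
    (hcont : ∀ u ∈ Ioc 0 t, ContinuousWithinAt f (Iic u) u) :
    ∫⁻ ω, ∏ i ∈ Finset.range (A t ω), ENNReal.ofReal (f (epoch A i ω)) ∂μ =
      ∫⁻ ω, ENNReal.ofReal (Real.exp (∫ u in (0 : ℝ)..t, (f u - 1) * lam u ω)) ∂μ := by
  obtain rfl | ht := ht.eq_or_lt
  · simp [hA.eq_zero 0 le_rfl]
  have hM0 : 0 ≤ M := (hf 0).trans (hfM 0)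
  have hlim : ∀ u ∈ Ioc 0 t, Tendsto (fun n => f (gridLeft t n u)) atTop (nhds (f u)) :=
    fun u hu => (hcont u hu).tendsto.comp (tendsto_gridLeft ht u)
  have hii : ∀ n ω, IntervalIntegrable (fun u => (f (gridLeft t n u) - 1) * lam u ω)
      volume 0 t := by
    intro n ω
    refine ((hint ω).const_mul (M + 1)).mono_fun' ?_ (Eventually.of_forall fun u => ?_)
    · exact (((measurable_comp_gridLeft f t n).sub_const 1).mul
        (hlam.comp (measurable_id.prodMk measurable_const))).aestronglyMeasurable
    · simp only
      rw [norm_mul, Real.norm_of_nonneg (hlam0 u ω)]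
      refine mul_le_mul_of_nonneg_right ?_ (hlam0 u ω)
      rw [Real.norm_eq_abs, abs_le]
      constructor <;> linarith [hf (gridLeft t n u), hfM (gridLeft t n u)]
  have hleft : Tendsto (fun n => ∫⁻ ω, ∏ i ∈ Finset.range (A t ω),
      ENNReal.ofReal (f (gridLeft t n (epoch A i ω))) ∂μ) atTop
      (nhds (∫⁻ ω, ∏ i ∈ Finset.range (A t ω), ENNReal.ofReal (f (epoch A i ω)) ∂μ)) := by
    refine tendsto_lintegral_of_dominated_convergence
      (fun ω => ∏ i ∈ Finset.range (A t ω), ENNReal.ofReal M) (fun n => ?_) (fun n => ?_) ?_ ?_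
    · simp_rw [fun ω => prod_range_epoch (N := A)
        (fun _ e => ENNReal.ofReal (f (gridLeft t n e))) t ω]
      exact measurable_prod_range (hA.measurable t) fun i =>
        ((measurable_comp_gridLeft f t n).comp (hA.measurable_truncEpoch t i)).ennreal_ofReal
    · exact Eventually.of_forall fun ω => Finset.prod_le_prod' fun i _ =>
        ENNReal.ofReal_le_ofReal (hfM _)
    -- The dominating variable is `M ^ A(t)`; the grid formula for the constant function `M` turns
    -- its integral into the one assumed finite in `hM`.
    · rw [h.lintegral_prod_gridLeft hA hlam hlam0 ht hint (f := fun _ => M) (fun _ => hM0) 0]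
      simpa only [intervalIntegral.integral_const_mul] using hM
    · refine Eventually.of_forall fun ω => ENNReal.tendsto_finsetProd_of_ne_top _
        (fun i hi => ?_) fun i _ => ENNReal.ofReal_ne_top
      have hi' := Finset.mem_range.1 hi
      exact ENNReal.tendsto_ofReal (hlim _ ⟨hA.epoch_pos hi', hA.epoch_le hi'⟩)
  have hright : Tendsto (fun n => ∫⁻ ω, ENNReal.ofReal
      (Real.exp (∫ u in (0 : ℝ)..t, (f (gridLeft t n u) - 1) * lam u ω)) ∂μ) atTop
      (nhds (∫⁻ ω, ENNReal.ofReal (Real.exp (∫ u in (0 : ℝ)..t, (f u - 1) * lam u ω)) ∂μ)) := by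
    refine tendsto_lintegral_of_dominated_convergence
      (fun ω => ENNReal.ofReal (Real.exp ((M - 1) * ∫ u in (0 : ℝ)..t, lam u ω)))
      (fun n => ?_) (fun n => ?_) hM ?_
    · refine (Real.measurable_exp.comp (measurable_intervalIntegral ?_ 0 t)).ennreal_ofReal
      exact (((measurable_comp_gridLeft f t n).comp measurable_fst).sub_const 1).mul hlam
    · refine Eventually.of_forall fun ω => ENNReal.ofReal_le_ofReal (Real.exp_le_exp.2 ?_)
      rw [← intervalIntegral.integral_const_mul]
      refine intervalIntegral.integral_mono_on ht.le (hii n ω) ((hint ω).const_mul _) fun u _ => ?_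
      exact mul_le_mul_of_nonneg_right (by linarith [hfM (gridLeft t n u)]) (hlam0 u ω)
    · refine Eventually.of_forall fun ω => ENNReal.tendsto_ofReal
        ((Real.continuous_exp.tendsto _).comp ?_)
      refine intervalIntegral.tendsto_integral_filter_of_dominated_convergence
        (fun u => (M + 1) * lam u ω) (Eventually.of_forall fun n => ?_)
        (Eventually.of_forall fun n => ?_) ((hint ω).const_mul _) ?_
      · rw [uIoc_of_le ht.le]
        exact (hii n ω).1.aestronglyMeasurable
      · refine Eventually.of_forall fun u _ => ?_
        rw [norm_mul, Real.norm_of_nonneg (hlam0 u ω)]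
        refine mul_le_mul_of_nonneg_right ?_ (hlam0 u ω)
        rw [Real.norm_eq_abs, abs_le]
        constructor <;> linarith [hf (gridLeft t n u), hfM (gridLeft t n u)]
      · refine Eventually.of_forall fun u hu => ?_
        rw [uIoc_of_le ht.le] at hu
        exact ((hlim u hu).sub_const 1).mul_const _
  refine tendsto_nhds_unique hleft (hright.congr fun n => ?_)
  exact (h.lintegral_prod_gridLeft hA hlam hlam0 ht hint hf n).symm

end DrivenProcess

/-! ### Poisson and Cox processes as mixed Poisson processes -/

section Increments

variable {Ω : Type*} {mΩ : MeasurableSpace Ω} {P : Measure Ω} [IsProbabilityMeasure P]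

lemma IsCountingProcess.measurableSet_increments {A : ℝ → Ω → ℕ} (hA : IsCountingProcess A) {n : ℕ}
    (τ : Fin (n + 1) → ℝ) (k : Fin n → ℕ) :
    MeasurableSet {ω | ∀ i : Fin n, A (τ i.succ) ω - A (τ i.castSucc) ω = k i} := by
  have hsub : Measurable fun p : ℕ × ℕ => p.1 - p.2 := .of_discrete
  rw [ofPred_forall]
  exact MeasurableSet.iInter fun i => (hsub.comp ((hA.measurable (τ i.succ)).prodMk
    (hA.measurable (τ i.castSucc)))) (measurableSet_singleton (k i))

lemma IsPoissonProcess.hasMixedPoissonIncrements {ν : ℝ} {S : ℝ → Ω → ℕ}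
    (hS : IsPoissonProcess P ν S) : HasMixedPoissonIncrements P (fun _ _ => ν) S := by
  intro n τ hτ hτ0 k
  have hset : {ω | ∀ i : Fin n, S (τ i.succ) ω - S (τ i.castSucc) ω = k i} =
      ⋂ i ∈ Finset.univ, (fun ω => S (τ i.succ) ω - S (τ i.castSucc) ω) ⁻¹' {k i} := by
    ext ω
    simp
  rw [hset, (hS.indep_increments n τ hτ).measure_inter_preimage_eq_mul Finset.univ
    fun i _ => measurableSet_singleton (k i)]
  simp only [lintegral_const, measure_univ, mul_one]
  refine Finset.prod_congr rfl fun i _ => ?_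
  have hlaw := hS.hasLaw_increment (τ i.castSucc) (τ i.succ)
    (hτ0.trans (hτ (Fin.zero_le _))) (hτ (Fin.castSucc_lt_succ (i := i)).le)
  rw [← Measure.map_apply_of_aemeasurable hlaw.aemeasurable (measurableSet_singleton _),
    hlaw.map_eq, intervalIntegral.integral_const, smul_eq_mul, mul_comm]

/-- Integrate the conditional probabilities over `F`. Allowing every `F` in the σ-algebra of the
rate encodes the conditioning without conditional expectations. -/
lemma IsCoxProcess.hasMixedPoissonIncrements {L : ℝ → Ω → ℝ} {A : ℝ → Ω → ℕ}
    (hA : IsCoxProcess P L A) (hL : sigmaAlgebra L ≤ mΩ) {F : Set Ω}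
    (hF : MeasurableSet[sigmaAlgebra L] F) : HasMixedPoissonIncrements (P.restrict F) L A := by
  intro n τ hτ hτ0 k
  have hE := hA.measurableSet_increments τ k
  have hcond := hA.cond_increments n τ hτ hτ0 k
  set E := {ω | ∀ i : Fin n, A (τ i.succ) ω - A (τ i.castSucc) ω = k i}
  have hint := integrable_condExp.congr hcond
  have h1 : P.real (E ∩ F) = ∫ ω in F, ∏ i : Fin n,
      (poissonMeasure (∫ u in (τ i.castSucc)..(τ i.succ), L u ω).toNNReal).real {k i} ∂P := by
    rw [← integral_congr_ae (ae_restrict_of_ae hcond),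
      setIntegral_condExp hL ((integrable_const (1 : ℝ)).indicator hE) hF, integral_indicator hE]
    simp [Measure.restrict_restrict hE]
  rw [Measure.restrict_apply hE, ← ofReal_measureReal, h1,
    ofReal_integral_eq_lintegral_ofReal hint.integrableOn
      (Eventually.of_forall fun ω => Finset.prod_nonneg fun i _ => measureReal_nonneg)]
  refine lintegral_congr fun ω => ?_
  rw [ENNReal.ofReal_prod_of_nonneg fun i _ => measureReal_nonneg]
  exact Finset.prod_congr rfl fun i _ => ofReal_measureReal

end Increments

/-! ### Uniqueness of generating functions -/

section GeneratingFunction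

/-- A summable sequence is determined by its generating function on `(0, 1]`. -/
lemma eq_zero_of_tsum_pow_eq_zero {c : ℕ → ℝ} (hc : Summable fun k => ‖c k‖)
    (h : ∀ z ∈ Ioc (0 : ℝ) 1, ∑' k, c k * z ^ k = 0) (k : ℕ) : c k = 0 := by
  induction k using Nat.strong_induction_on with
  | _ k ih =>
    have hck : Summable fun j => ‖c (j + k)‖ := (summable_nat_add_iff k).2 hc
    have hcont : ContinuousOn (fun z : ℝ => ∑' j, c (j + k) * z ^ j) (Icc 0 1) := by
      refine continuousOn_tsum (fun j => by fun_prop) hck fun j z hz => ?_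
      rw [norm_mul, norm_pow, Real.norm_of_nonneg hz.1]
      exact mul_le_of_le_one_right (norm_nonneg _) (pow_le_one₀ hz.1 hz.2)
    -- The terms below `k` vanish by induction, so `z ^ k` can be divided out for `z > 0`; letting
    -- `z` decrease to `0` then isolates `c k`.
    have hzero : ∀ z ∈ Ioc (0 : ℝ) 1, ∑' j, c (j + k) * z ^ j = 0 := by
      intro z hz
      have hs : Summable fun j => c j * z ^ j := by
        refine Summable.of_norm_bounded hc fun j => ?_
        rw [norm_mul, norm_pow, Real.norm_of_nonneg hz.1.le]
        exact mul_le_of_le_one_right (norm_nonneg _) (pow_le_one₀ hz.1.le hz.2)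
      have hsplit := hs.sum_add_tsum_nat_add k
      rw [h z hz, Finset.sum_eq_zero fun j hj => by rw [ih j (Finset.mem_range.1 hj), zero_mul],
        zero_add] at hsplit
      simp_rw [pow_add, ← mul_assoc] at hsplit
      rw [tsum_mul_right] at hsplit
      exact (mul_eq_zero.1 hsplit).resolve_right (pow_ne_zero _ hz.1.ne')
    have hlim : Tendsto (fun z : ℝ => ∑' j, c (j + k) * z ^ j) (nhdsWithin 0 (Ioc 0 1))
        (nhds (∑' j, c (j + k) * (0 : ℝ) ^ j)) :=
      (hcont 0 (by simp)).tendsto.mono_left (nhdsWithin_mono _ Ioc_subset_Icc_self)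
    have hne : (nhdsWithin (0 : ℝ) (Ioc 0 1)).NeBot := by
      rw [nhdsWithin_Ioc_eq_nhdsGT one_pos]
      infer_instance
    have heq := tendsto_nhds_unique hlim (tendsto_const_nhds.congr'
      (eventually_nhdsWithin_of_forall fun z hz => (hzero z hz).symm))
    rw [tsum_eq_single 0 fun j hj => by simp [hj]] at heq
    simpa using heq

lemma eq_of_tsum_pow_eq {a b : ℕ → ℝ≥0∞} (ha : ∑' k, a k ≠ ∞)
    (h : ∀ z ∈ Ioc (0 : ℝ) 1,
      ∑' k, ENNReal.ofReal z ^ k * a k = ∑' k, ENNReal.ofReal z ^ k * b k) : a = b := by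
  have hb : ∑' k, b k ≠ ∞ := by
    have := h 1 (by simp)
    simp only [ENNReal.ofReal_one, one_pow, one_mul] at this
    rwa [← this]
  have ha' := ENNReal.ne_top_of_tsum_ne_top ha
  have hb' := ENNReal.ne_top_of_tsum_ne_top hb
  have hsa := ENNReal.summable_toReal ha
  have hsb := ENNReal.summable_toReal hb
  have hzero := eq_zero_of_tsum_pow_eq_zero (c := fun k => (a k).toReal - (b k).toReal)
    (hsa.sub hsb).norm fun z hz => by
      have key : ∀ d : ℕ → ℝ≥0∞, ∑' k, d k ≠ ∞ → (Summable fun k => (d k).toReal * z ^ k) ∧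
          ∑' k, (d k).toReal * z ^ k = (∑' k, ENNReal.ofReal z ^ k * d k).toReal := by
        intro d hd
        have hterm : ∀ k, (ENNReal.ofReal z ^ k * d k).toReal = (d k).toReal * z ^ k := fun k => by
          rw [ENNReal.toReal_mul, ENNReal.toReal_pow, ENNReal.toReal_ofReal hz.1.le, mul_comm]
        have hle : ∀ k, ENNReal.ofReal z ^ k * d k ≤ d k := fun k =>
          mul_le_of_le_one_left' (pow_le_one₀ zero_le (ENNReal.ofReal_le_one.2 hz.2))
        have hfin : ∑' k, ENNReal.ofReal z ^ k * d k ≠ ∞ :=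
          ne_top_of_le_ne_top hd (ENNReal.tsum_le_tsum hle)
        refine ⟨(ENNReal.summable_toReal hfin).congr hterm, ?_⟩
        rw [ENNReal.tsum_toReal_eq (ENNReal.ne_top_of_tsum_ne_top hfin)]
        exact tsum_congr fun k => (hterm k).symm
      simp_rw [sub_mul]
      rw [(key a ha).1.tsum_sub (key b hb).1, (key a ha).2, (key b hb).2, h z hz, sub_self]
  funext k
  exact (ENNReal.toReal_eq_toReal_iff' (ha' k) (hb' k)).1 (sub_eq_zero.1 (hzero k))

end GeneratingFunction

/-! ### Conditional Poisson laws and their transforms -/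

section MixedPoisson

variable {Ω : Type*}

lemma tsum_pow_mul_poissonMeasure {z : ℝ} (hz : 0 ≤ z) {x : ℝ} (hx : 0 ≤ x) :
    ∑' k : ℕ, ENNReal.ofReal z ^ k * poissonMeasure x.toNNReal {k} =
      ENNReal.ofReal (Real.exp ((z - 1) * x)) := by
  rw [← lintegral_countable' (fun k => ENNReal.ofReal z ^ k), lintegral_pow_poissonMeasure _ hz,
    Real.coe_toNNReal _ hx]

lemma lintegral_comp_nat_mul {mΩ : MeasurableSpace Ω} {P : Measure Ω} {N : Ω → ℕ}
    (hN : Measurable N) (c : ℕ → ℝ≥0∞) {y : Ω → ℝ≥0∞} (hy : Measurable y) :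
    ∫⁻ ω, c (N ω) * y ω ∂P = ∑' k, c k * ∫⁻ ω in {ω | N ω = k}, y ω ∂P := by
  have hset : ∀ k, MeasurableSet {ω | N ω = k} := fun k => hN (measurableSet_singleton k)
  have hpt : ∀ ω, c (N ω) * y ω = ∑' k, c k * ({ω | N ω = k}.indicator y ω) := fun ω => by
    rw [tsum_eq_single (N ω) fun k hk => by simp [hk.symm]]
    simp
  simp_rw [hpt]
  rw [lintegral_tsum fun k => ((hy.indicator (hset k)).const_mul _).aemeasurable]
  refine tsum_congr fun k => ?_
  rw [lintegral_const_mul _ (hy.indicator (hset k)), lintegral_indicator (hset k)]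

variable {m mΩ : MeasurableSpace Ω} {P : Measure Ω} {N : Ω → ℕ} {x : Ω → ℝ}

/-- Conditionally on `m`, the random variable `N` is Poisson distributed with parameter `x`. -/
def HasMixedPoissonLaw (m : MeasurableSpace Ω) {mΩ : MeasurableSpace Ω} (P : Measure Ω) (N : Ω → ℕ)
    (x : Ω → ℝ) : Prop :=
  ∀ F, MeasurableSet[m] F → ∀ k : ℕ,
    P ({ω | N ω = k} ∩ F) = ∫⁻ ω in F, poissonMeasure (x ω).toNNReal {k} ∂P

lemma hasMixedPoissonLaw_of_lintegral_pow [IsFiniteMeasure P] (hN : Measurable N)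
    (hx : Measurable x) (hx0 : ∀ ω, 0 ≤ x ω)
    (h : ∀ F, MeasurableSet[m] F → ∀ z ∈ Ioc (0 : ℝ) 1, ∫⁻ ω in F, ENNReal.ofReal z ^ N ω ∂P =
      ∫⁻ ω in F, ENNReal.ofReal (Real.exp ((z - 1) * x ω)) ∂P) : HasMixedPoissonLaw m P N x := by
  intro F hF k
  have hset : ∀ k, MeasurableSet {ω | N ω = k} := fun k => hN (measurableSet_singleton k)
  have hexp : ∀ z : ℝ, ∫⁻ ω in F, ENNReal.ofReal z ^ N ω ∂P =
      ∑' k, ENNReal.ofReal z ^ k * P ({ω | N ω = k} ∩ F) := by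
    intro z
    have := lintegral_comp_nat_mul (P := P.restrict F) hN (fun k => ENNReal.ofReal z ^ k)
      (y := fun _ => 1) measurable_const
    simp only [mul_one, lintegral_const, one_mul, Measure.restrict_apply MeasurableSet.univ,
      univ_inter] at this
    rw [this]
    exact tsum_congr fun k => by rw [Measure.restrict_apply (hset k)]
  refine congr_fun (eq_of_tsum_pow_eq (a := fun k => P ({ω | N ω = k} ∩ F))
    (b := fun k => ∫⁻ ω in F, poissonMeasure (x ω).toNNReal {k} ∂P) ?_ fun z hz => ?_) k
  · have := hexp 1
    simp only [ENNReal.ofReal_one, one_pow, lintegral_one, one_mul] at this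
    rw [← this]
    exact measure_ne_top _ _
  · have hpm := fun k => measurable_poissonMeasure_singleton hx k
    rw [← hexp, h F hF z hz]
    simp_rw [← fun ω => tsum_pow_mul_poissonMeasure hz.1.le (hx0 ω)]
    rw [lintegral_tsum fun k => ((hpm k).const_mul _).aemeasurable]
    exact tsum_congr fun k => lintegral_const_mul _ (hpm k)

lemma HasMixedPoissonLaw.condExp_ae_eq [IsFiniteMeasure P] (h : HasMixedPoissonLaw m P N x)
    (hm : m ≤ mΩ) (hN : Measurable N) (hx : Measurable[m] x) (k : ℕ) :
    P⟦{ω | N ω = k} | m⟧ =ᵐ[P] fun ω => (poissonMeasure (x ω).toNNReal).real {k} := by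
  have hset : MeasurableSet {ω | N ω = k} := hN (measurableSet_singleton k)
  have hmeas : Measurable[m] fun ω => (poissonMeasure (x ω).toNNReal).real {k} :=
    (measurable_poissonMeasure_singleton (mΩ := m) hx k).ennreal_toReal
  have hint : Integrable (fun ω => (poissonMeasure (x ω).toNNReal).real {k}) P :=
    Integrable.of_bound (hmeas.mono hm le_rfl).aestronglyMeasurable 1
      (Eventually.of_forall fun ω => by
        rw [Real.norm_of_nonneg measureReal_nonneg]
        exact measureReal_le_one)
  refine (ae_eq_condExp_of_forall_setIntegral_eq hm ((integrable_const (1 : ℝ)).indicator hset)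
    (fun F _ _ => hint.integrableOn) (fun F hF _ => ?_)
    hmeas.stronglyMeasurable.aestronglyMeasurable).symm
  rw [integral_indicator hset, integral_eq_lintegral_of_nonneg_ae
    (Eventually.of_forall fun ω => measureReal_nonneg) hint.1.restrict]
  rw [lintegral_congr (g := fun ω => poissonMeasure (x ω).toNNReal {k})
    fun ω => ofReal_measureReal, ← h F hF k, Measure.restrict_restrict hset]
  simp [measureReal_def]

/-- `P` restricted to `{N = k}` and `P` with the Poisson weight as density agree on `m`, hence on
`m`-measurable integrands; `trim` expresses this. -/
lemma HasMixedPoissonLaw.setLIntegral_eq (h : HasMixedPoissonLaw m P N x)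
    (hm : m ≤ mΩ) (hN : Measurable N) (hx : Measurable x) {y : Ω → ℝ≥0∞} (hy : Measurable[m] y)
    (k : ℕ) :
    ∫⁻ ω in {ω | N ω = k}, y ω ∂P = ∫⁻ ω, poissonMeasure (x ω).toNNReal {k} * y ω ∂P := by
  have hset : MeasurableSet {ω | N ω = k} := hN (measurableSet_singleton k)
  have hpm := measurable_poissonMeasure_singleton hx k
  have htrim : (P.restrict {ω | N ω = k}).trim hm =
      (P.withDensity fun ω => poissonMeasure (x ω).toNNReal {k}).trim hm := by
    refine @Measure.ext _ m _ _ fun F hF => ?_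
    rw [trim_measurableSet_eq hm hF, trim_measurableSet_eq hm hF,
      Measure.restrict_apply (hm _ hF), withDensity_apply _ (hm _ hF), inter_comm]
    exact h F hF k
  rw [← lintegral_trim hm hy, htrim, lintegral_trim hm hy,
    lintegral_withDensity_eq_lintegral_mul _ hpm (hy.mono hm le_rfl)]
  rfl

lemma HasMixedPoissonLaw.lintegral_pow_mul (h : HasMixedPoissonLaw m P N x)
    (hm : m ≤ mΩ) (hN : Measurable N) (hx : Measurable x) (hx0 : ∀ ω, 0 ≤ x ω) {y : Ω → ℝ≥0∞}
    (hy : Measurable[m] y) {z : ℝ} (hz : 0 ≤ z) :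
    ∫⁻ ω, ENNReal.ofReal z ^ N ω * y ω ∂P =
      ∫⁻ ω, ENNReal.ofReal (Real.exp ((z - 1) * x ω)) * y ω ∂P := by
  have hpm := fun k => measurable_poissonMeasure_singleton hx k
  have hy' : Measurable y := hy.mono hm le_rfl
  rw [lintegral_comp_nat_mul hN (fun k => ENNReal.ofReal z ^ k) hy']
  simp_rw [← fun ω => tsum_pow_mul_poissonMeasure hz (hx0 ω), ← ENNReal.tsum_mul_right]
  have hpy : ∀ k, Measurable fun ω => poissonMeasure (x ω).toNNReal {k} * y ω :=
    fun k => (hpm k).mul hy'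
  simp_rw [mul_assoc]
  rw [lintegral_tsum fun k => ((hpy k).const_mul _).aemeasurable]
  refine tsum_congr fun k => ?_
  rw [lintegral_const_mul _ (hpy k), h.setLIntegral_eq hm hN hx hy]

/-- The absolute value of the integrand is `|z| ^ N * y`, so the nonnegative identity
`lintegral_pow_mul` at `|z|` transfers finiteness. -/
lemma HasMixedPoissonLaw.integrable_exp (h : HasMixedPoissonLaw m P N x)
    (hm : m ≤ mΩ) (hN : Measurable N) (hx : Measurable x) (hx0 : ∀ ω, 0 ≤ x ω) {y : Ω → ℝ}
    (hy : Measurable[m] y) (hy0 : ∀ ω, 0 ≤ y ω) {z : ℝ}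
    (hint : Integrable (fun ω => z ^ N ω * y ω) P) :
    Integrable (fun ω => Real.exp ((|z| - 1) * x ω) * y ω) P := by
  have hy' : Measurable y := hy.mono hm le_rfl
  refine ⟨by fun_prop, ?_⟩
  have hfin := hint.2
  rw [hasFiniteIntegral_iff_enorm] at hfin ⊢
  have h1 : ∀ ω, ‖z ^ N ω * y ω‖ₑ = ENNReal.ofReal |z| ^ N ω * ENNReal.ofReal (y ω) := fun ω => by
    rw [enorm_mul, enorm_pow, Real.enorm_eq_ofReal_abs, Real.enorm_of_nonneg (hy0 ω)]
  have h2 : ∀ ω, ‖Real.exp ((|z| - 1) * x ω) * y ω‖ₑ =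
      ENNReal.ofReal (Real.exp ((|z| - 1) * x ω)) * ENNReal.ofReal (y ω) := fun ω => by
    rw [enorm_mul, Real.enorm_of_nonneg (Real.exp_nonneg _), Real.enorm_of_nonneg (hy0 ω)]
  simp_rw [h1] at hfin
  simp_rw [h2]
  rwa [← h.lintegral_pow_mul hm hN hx hx0 hy.ennreal_ofReal (abs_nonneg z)]

/-- For `z` of either sign, split by the value of `N` and resum the exponential series; the assumed
integrability gives the absolute convergence needed for the exchange. -/
lemma HasMixedPoissonLaw.integral_pow_mul (h : HasMixedPoissonLaw m P N x)
    (hm : m ≤ mΩ) (hN : Measurable N) (hx : Measurable x) (hx0 : ∀ ω, 0 ≤ x ω) {y : Ω → ℝ}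
    (hy : Measurable[m] y) (hy0 : ∀ ω, 0 ≤ y ω) {z : ℝ}
    (hint : Integrable (fun ω => z ^ N ω * y ω) P) :
    ∫ ω, z ^ N ω * y ω ∂P = ∫ ω, Real.exp ((z - 1) * x ω) * y ω ∂P := by
  have hy' : Measurable y := hy.mono hm le_rfl
  have hset : ∀ k, MeasurableSet {ω | N ω = k} := fun k => hN (measurableSet_singleton k)
  have hpm : ∀ k, Measurable fun ω => (poissonMeasure (x ω).toNNReal).real {k} :=
    fun k => (measurable_poissonMeasure_singleton hx k).ennreal_toReal
  let f : ℕ → Ω → ℝ := fun k ω => z ^ k * ((poissonMeasure (x ω).toNNReal).real {k} * y ω)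
  have hunion : ⋃ k, {ω | N ω = k} = univ := by
    ext ω
    simp
  have hterm : ∀ k, ∫ ω in {ω | N ω = k}, z ^ N ω * y ω ∂P = ∫ ω, f k ω ∂P := by
    intro k
    have h1 : ∫ ω in {ω | N ω = k}, z ^ N ω * y ω ∂P = ∫ ω in {ω | N ω = k}, z ^ k * y ω ∂P :=
      setIntegral_congr_fun (hset k) fun ω hω => by
        have : N ω = k := hω
        simp only [this]
    rw [h1, integral_const_mul, integral_const_mul,
      integral_eq_lintegral_of_nonneg_ae (Eventually.of_forall hy0)
        hy'.aestronglyMeasurable,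
      integral_eq_lintegral_of_nonneg_ae
        (Eventually.of_forall fun ω => mul_nonneg measureReal_nonneg (hy0 ω))
        ((hpm k).mul hy').aestronglyMeasurable,
      h.setLIntegral_eq hm hN hx hy.ennreal_ofReal]
    congr 2
    refine lintegral_congr fun ω => ?_
    rw [ENNReal.ofReal_mul measureReal_nonneg, ofReal_measureReal]
  have hpt : ∀ ω, ∑' k, f k ω = Real.exp ((z - 1) * x ω) * y ω := by
    intro ω
    have hs := ((NormedSpace.expSeries_div_hasSum_exp (z * x ω : ℝ)).mul_left
      (Real.exp (-x ω))).mul_right (y ω)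
    rw [← Real.exp_eq_exp_ℝ, ← Real.exp_add] at hs
    have hexp : -x ω + z * x ω = (z - 1) * x ω := by ring
    rw [← hexp, ← hs.tsum_eq]
    refine tsum_congr fun k => ?_
    simp only [f]
    rw [poissonMeasure_real_singleton, Real.coe_toNNReal _ (hx0 ω), mul_pow]
    ring
  have hfin : ∑' k, ∫⁻ ω, ‖f k ω‖ₑ ∂P ≠ ∞ := by
    have hnorm : ∀ k, ∫⁻ ω, ‖f k ω‖ₑ ∂P =
        ENNReal.ofReal |z| ^ k * ∫⁻ ω in {ω | N ω = k}, ENNReal.ofReal (y ω) ∂P := by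
      intro k
      have hpy : Measurable fun ω => poissonMeasure (x ω).toNNReal {k} * ENNReal.ofReal (y ω) :=
        (measurable_poissonMeasure_singleton hx k).mul hy'.ennreal_ofReal
      rw [h.setLIntegral_eq hm hN hx hy.ennreal_ofReal, ← lintegral_const_mul _ hpy]
      refine lintegral_congr fun ω => ?_
      simp only [f]
      rw [enorm_mul, enorm_mul, enorm_pow, Real.enorm_eq_ofReal_abs, Real.enorm_of_nonneg (hy0 ω),
        Real.enorm_of_nonneg measureReal_nonneg, ofReal_measureReal]
    simp_rw [hnorm]
    rw [← lintegral_comp_nat_mul hN (fun k => ENNReal.ofReal |z| ^ k) hy'.ennreal_ofReal]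
    refine ne_of_eq_of_ne (lintegral_congr fun ω => ?_) hint.2.ne
    rw [enorm_mul, enorm_pow, Real.enorm_eq_ofReal_abs, Real.enorm_of_nonneg (hy0 ω)]
  calc ∫ ω, z ^ N ω * y ω ∂P
      = ∫ ω in ⋃ k, {ω | N ω = k}, z ^ N ω * y ω ∂P := by rw [hunion, setIntegral_univ]
    _ = ∑' k, ∫ ω in {ω | N ω = k}, z ^ N ω * y ω ∂P := by
        refine integral_iUnion hset (fun i j hij => ?_) hint.integrableOn
        exact Set.disjoint_left.2 fun ω hi hj => hij (hi.symm.trans hj)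
    _ = ∑' k, ∫ ω, f k ω ∂P := tsum_congr hterm
    _ = ∫ ω, ∑' k, f k ω ∂P :=
        (integral_tsum (fun k => (((hpm k).mul hy').const_mul _).aestronglyMeasurable) hfin).symm
    _ = _ := integral_congr_ae (Eventually.of_forall hpt)

end MixedPoisson

/-! ### Probability that a job is still present -/

section ResidualTail

variable {Ω : Type*} {mΩ : MeasurableSpace Ω} {P : Measure Ω} {X : Ω → ℝ} {t : ℝ}

/-- The probability that a job with service requirement `X` which arrives at time `u` is still
present at time `t`. -/
noncomputable def residualTail (P : Measure Ω) (X : Ω → ℝ) (t u : ℝ) : ℝ :=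
  P.real {ω | t - u < X ω}

lemma residualTail_nonneg (u : ℝ) : 0 ≤ residualTail P X t u := measureReal_nonneg

variable [IsProbabilityMeasure P]

lemma residualTail_le_one (u : ℝ) : residualTail P X t u ≤ 1 := measureReal_le_one

lemma monotone_residualTail : Monotone (residualTail P X t) := fun u v huv => by
  refine measureReal_mono fun ω (hω : t - u < X ω) => ?_
  show t - v < X ω
  linarith

lemma measurable_residualTail : Measurable (residualTail P X t) := monotone_residualTail.measurable

/-- Because the inequality is strict, the events increase to `{t - u < X}` as `v` increases to `u`.
Atoms of `X` may cause jumps from the right. -/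
lemma residualTail_leftCont (hX : Measurable X) (u : ℝ) :
    ContinuousWithinAt (residualTail P X t) (Iic u) u := by
  have h : Tendsto (fun v => P {ω | t - v < X ω}) (nhdsWithin u (Iic u))
      (nhds (P {ω | t - u < X ω})) := by
    refine tendsto_measure_of_tendsto_indicator_of_isFiniteMeasure _ P
      (fun v => measurableSet_lt measurable_const hX) fun ω => ?_
    by_cases hω : t - u < X ω
    · have hc : Tendsto (fun v : ℝ => t - v) (nhdsWithin u (Iic u)) (nhds (t - u)) :=
        (by fun_prop : Continuous fun v : ℝ => t - v).continuousWithinAt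
      filter_upwards [hc.eventually_lt_const hω] with v hv
      exact ⟨fun _ => hω, fun _ => hv⟩
    · filter_upwards [self_mem_nhdsWithin] with v hv
      have hv' : v ≤ u := hv
      refine ⟨fun h => ?_, fun h => absurd h hω⟩
      have h' : t - v < X ω := h
      show t - u < X ω
      linarith
  exact (ENNReal.tendsto_toReal (measure_ne_top _ _)).comp h

lemma lintegral_ite_eq_residualTail (hX : Measurable X) {z : ℝ} (hz : z ∈ Icc (0 : ℝ) 1) (u : ℝ) :
    ∫⁻ ω, (if t < u + X ω then ENNReal.ofReal z else 1) ∂P =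
      ENNReal.ofReal (1 - (1 - z) * residualTail P X t u) := by
  have hS : MeasurableSet {ω | t - u < X ω} := measurableSet_lt measurable_const hX
  have hind : Integrable ({ω | t - u < X ω}.indicator (1 : Ω → ℝ)) P :=
    (integrable_const (1 : ℝ)).indicator hS
  have hsub : Integrable
      (fun ω => 1 - (1 - z) * {ω | t - u < X ω}.indicator (1 : Ω → ℝ) ω) P :=
    (integrable_const _).sub (hind.const_mul _)
  have hint : ∫ ω, (1 - (1 - z) * {ω | t - u < X ω}.indicator (1 : Ω → ℝ) ω) ∂P =
      1 - (1 - z) * residualTail P X t u := by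
    rw [integral_sub (integrable_const _) (hind.const_mul _), integral_const_mul,
      integral_indicator_one hS]
    simp [residualTail]
  rw [← hint, ofReal_integral_eq_lintegral_ofReal hsub]
  · refine lintegral_congr fun ω => ?_
    by_cases h : t < u + X ω
    · have h' : t - u < X ω := by linarith
      simp [h, h']
    · have h' : ¬ t - u < X ω := fun hlt => h (by linarith)
      simp [h, h']
  · refine Eventually.of_forall fun ω => ?_
    by_cases h' : t - u < X ω
    · simp [h', hz.1]
    · simp [h']

end ResidualTail

/-! ### Conditional law of the number of jobs -/

section Queue

variable {Ω : Type*} {mΩ : MeasurableSpace Ω} {P : Measure Ω} [IsProbabilityMeasure P]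

lemma sigmaAlgebra_le {L : ℝ → Ω → ℝ} (hL : ∀ u, Measurable (L u)) : sigmaAlgebra L ≤ mΩ :=
  iSup_le fun u => (hL u).comap_le

lemma measurable_sigmaAlgebra {Ω : Type*} (L : ℝ → Ω → ℝ) (u : ℝ) :
    Measurable[sigmaAlgebra L] (L u) :=
  Measurable.of_comap_le (le_iSup (fun t : ℝ => MeasurableSpace.comap (L t) inferInstance) u)

/-- Conditionally on the rate, the number of jobs in the infinite-server queue is Poisson. -/
lemma IsCoxProcess.hasMixedPoissonLaw_numJobs {L : ℝ → Ω → ℝ} {A : ℝ → Ω → ℕ}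
    (hA : IsCoxProcess P L A) (hL : ∀ u, Measurable (L u)) (hL0 : ∀ u ω, 0 ≤ L u ω)
    (hLc : ∀ ω u, ContinuousWithinAt (fun v => L v ω) (Ici u) u) {t : ℝ} (ht : 0 ≤ t)
    (hLi : ∀ ω, IntervalIntegrable (fun u => L u ω) volume 0 t) {J : ℕ → Ω → ℝ}
    (hJ : ∀ i, Measurable (J i)) (hJ_indep : iIndepFun J P)
    (hJ_ident : ∀ i, IdentDistrib (J i) (J 0) P P)
    (hJLA : IndepFun (fun ω (i : ℕ) => J i ω)
      (fun ω => ((fun u : ℝ => L u ω), (fun u : ℝ => A u ω))) P) :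
    HasMixedPoissonLaw (sigmaAlgebra L) P (numJobs A J t)
      (fun ω => ∫ u in (0 : ℝ)..t, residualTail P (J 0) t u * L u ω) := by
  have hAc : IsCountingProcess A := hA.toIsCountingProcess
  have hLj := measurable_uncurry_of_rightCont hL hLc
  -- Services are independent of rate and arrivals jointly, so mixing is done over the σ-algebra of
  -- the pair, which contains both `F` and the arrival epochs.
  let W : Ω → (ℝ → ℝ) × (ℝ → ℕ) := fun ω => (fun u => L u ω, fun u => A u ω)
  have hW : Measurable W := (measurable_pi_lambda _ hL).prodMk
    (measurable_pi_lambda _ hAc.measurable)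
  have hWL : ∀ u, Measurable[MeasurableSpace.comap W inferInstance] (L u) := fun u =>
    ((measurable_pi_apply u).comp measurable_fst).comp (comap_measurable W)
  have hWA : ∀ u, Measurable[MeasurableSpace.comap W inferInstance] (A u) := fun u =>
    ((measurable_pi_apply u).comp measurable_snd).comp (comap_measurable W)
  have hLW : sigmaAlgebra L ≤ MeasurableSpace.comap W inferInstance :=
    iSup_le fun u => (hWL u).comap_le
  refine hasMixedPoissonLaw_of_lintegral_pow (measurable_numJobs hAc hJ t)
    (measurable_intervalIntegral
      ((measurable_residualTail.comp measurable_fst).mul hLj) 0 t)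
    (fun ω => intervalIntegral.integral_nonneg ht fun u _ =>
      mul_nonneg (residualTail_nonneg u) (hL0 u ω)) fun F hF z hz => ?_
  have hz' : z ∈ Icc (0 : ℝ) 1 := Ioc_subset_Icc_self hz
  let φ : ℝ × ℝ → ℝ≥0∞ := fun p => if t < p.2 + p.1 then ENNReal.ofReal z else 1
  have hφ : Measurable φ := Measurable.ite (measurableSet_lt (by fun_prop) (by fun_prop))
    measurable_const measurable_const
  have hf0 : ∀ u, 0 ≤ 1 - (1 - z) * residualTail P (J 0) t u := fun u => by
    nlinarith [residualTail_le_one (P := P) (X := J 0) (t := t) u, hz.1, hz.2,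
      residualTail_nonneg (P := P) (X := J 0) (t := t) u]
  have hf1 : ∀ u, 1 - (1 - z) * residualTail P (J 0) t u ≤ 1 := fun u => by
    nlinarith [residualTail_nonneg (P := P) (X := J 0) (t := t) u, hz.2]
  calc ∫⁻ ω in F, ENNReal.ofReal z ^ numJobs A J t ω ∂P
      = ∫⁻ ω in F, ∏ i ∈ Finset.range (A t ω), φ (J i ω, epoch A i ω) ∂P := by
        refine lintegral_congr fun ω => ?_
        simp only [φ, numJobs]
        rw [Finset.prod_ite, Finset.prod_const, Finset.prod_const_one, mul_one]
    _ = ∫⁻ ω in F, ∏ i ∈ Finset.range (A t ω), (∫⁻ ω', φ (J 0 ω', epoch A i ω) ∂P) ∂P :=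
        lintegral_prod_epoch hW.comap_le hAc hJ hJ_indep hJ_ident hWA
          ((IndepFun_iff_Indep _ _ _).1 hJLA) hφ (hLW _ hF) t
    _ = ∫⁻ ω in F, ∏ i ∈ Finset.range (A t ω),
          ENNReal.ofReal (1 - (1 - z) * residualTail P (J 0) t (epoch A i ω)) ∂P := by
        simp only [φ, lintegral_ite_eq_residualTail (hJ 0) hz']
    _ = ∫⁻ ω in F, ENNReal.ofReal (Real.exp (∫ u in (0 : ℝ)..t,
          ((1 - (1 - z) * residualTail P (J 0) t u) - 1) * L u ω)) ∂P := by
        -- For `z` in `(0, 1]` the factor lies in `[0, 1]`, so `M = 1` works and the domination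
        -- hypothesis needs no moment of the rate.
        refine (hA.hasMixedPoissonIncrements (sigmaAlgebra_le hL) hF).lintegral_prod_epoch hAc hLj
          hL0 ht hLi (M := 1) (by simp) hf0 hf1 fun u _ => ?_
        exact continuousWithinAt_const.sub
          (continuousWithinAt_const.mul (residualTail_leftCont (hJ 0) u))
    _ = _ := by
        refine lintegral_congr fun ω => ?_
        rw [← intervalIntegral.integral_const_mul]
        congr 2
        refine intervalIntegral.integral_congr fun u _ => ?_
        ring

end Queue

/-! ### Linear functionals of the shot noise -/

section ShotNoise

variable {Ω : Type*} {mΩ : MeasurableSpace Ω} {r t : ℝ} {S : ℝ → Ω → ℕ} {B : ℕ → Ω → ℝ}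

lemma intervalIntegrable_of_abs_le_one {q k : ℝ → ℝ} (hq : Measurable q) (hq1 : ∀ u, |q u| ≤ 1)
    {a b : ℝ} (hk : IntervalIntegrable k volume a b) :
    IntervalIntegrable (fun u => q u * k u) volume a b := by
  refine hk.norm.mono_fun (hq.aestronglyMeasurable.mul hk.aestronglyMeasurable_restrict_uIoc)
    (Eventually.of_forall fun u => ?_)
  simp only [norm_mul, norm_norm]
  exact mul_le_of_le_one_left (norm_nonneg _) (hq1 u)

lemma intervalIntegrable_shotNoise (hr : 0 ≤ r) (hS : IsCountingProcess S)
    (hB : ∀ i, Measurable (B i)) (hB0 : ∀ i ω, 0 ≤ B i ω) (ht : 0 ≤ t) (ω : Ω) :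
    IntervalIntegrable (fun u => shotNoise r S B u ω) volume 0 t := by
  have hm : Measurable fun u => shotNoise r S B u ω :=
    (measurable_uncurry_of_rightCont (measurable_shotNoise hS hB)
      (shotNoise_rightCont hS B)).comp (measurable_id.prodMk measurable_const)
  refine (intervalIntegrable_const (c := ∑ i ∈ Finset.range (S t ω), B i ω)).mono_fun'
    hm.aestronglyMeasurable ?_
  rw [uIoc_of_le ht, EventuallyLE, ae_restrict_iff' measurableSet_Ioc]
  refine Eventually.of_forall fun u hu => ?_
  rw [Real.norm_of_nonneg (shotNoise_nonneg hB0 u ω)]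
  exact shotNoise_le hr hS hB0 hu.2 ω

lemma integral_mul_shotNoise {q : ℝ → ℝ} (hq : Measurable q) (hq1 : ∀ u, |q u| ≤ 1)
    (hS : IsCountingProcess S) (ht : 0 ≤ t) (ω : Ω) :
    ∫ u in (0 : ℝ)..t, q u * shotNoise r S B u ω = ∑ i ∈ Finset.range (S t ω),
      Real.exp (r * epoch S i ω) * (∫ u in (epoch S i ω)..t, q u * Real.exp (-r * u)) * B i ω := by
  have hk : ∀ i, Continuous fun u : ℝ => B i ω * Real.exp (-r * (u - epoch S i ω)) :=
    fun i => by fun_prop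
  have hint : ∀ i, IntervalIntegrable
      (fun u => q u * (B i ω * Real.exp (-r * (u - epoch S i ω)))) volume 0 t := fun i =>
    intervalIntegrable_of_abs_le_one hq hq1 ((hk i).intervalIntegrable 0 t)
  have hind : ∀ i u, q u * (Ici (epoch S i ω)).indicator
      (fun u => B i ω * Real.exp (-r * (u - epoch S i ω))) u =
      (Ici (epoch S i ω)).indicator
        (fun u => q u * (B i ω * Real.exp (-r * (u - epoch S i ω)))) u := fun i u =>
    (indicator_mul_right _ q _).symm
  have hsum : ∫ u in (0 : ℝ)..t, q u * shotNoise r S B u ω =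
      ∫ u in (0 : ℝ)..t, ∑ i ∈ Finset.range (S t ω), (Ici (epoch S i ω)).indicator
        (fun u => q u * (B i ω * Real.exp (-r * (u - epoch S i ω)))) u := by
    refine intervalIntegral.integral_congr fun u hu => ?_
    rw [uIcc_of_le ht] at hu
    rw [shotNoise_eq_sum_indicator hS B hu.2, Finset.mul_sum]
    exact Finset.sum_congr rfl fun i _ => hind i u
  rw [hsum, intervalIntegral.integral_finsetSum]
  · refine Finset.sum_congr rfl fun i hi => ?_
    have hi' := Finset.mem_range.1 hi
    have hpos := hS.epoch_pos hi'
    have hle := hS.epoch_le hi'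
    have hset : Ioc 0 t ∩ Ici (epoch S i ω) = Icc (epoch S i ω) t := by
      ext u
      simp only [mem_inter_iff, mem_Ioc, mem_Ici, mem_Icc]
      exact ⟨fun h => ⟨h.2, h.1.2⟩, fun h => ⟨⟨hpos.trans_le h.1, h.2⟩, h.1⟩⟩
    rw [intervalIntegral.integral_of_le ht, setIntegral_indicator measurableSet_Ici, hset,
      integral_Icc_eq_integral_Ioc, ← intervalIntegral.integral_of_le hle,
      ← intervalIntegral.integral_const_mul, ← intervalIntegral.integral_mul_const]
    refine intervalIntegral.integral_congr fun u _ => ?_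
    have hexp : Real.exp (-r * (u - epoch S i ω)) =
        Real.exp (r * epoch S i ω) * Real.exp (-r * u) := by
      rw [← Real.exp_add]
      congr 1
      ring
    simp only [hexp]
    ring
  · intro i _
    exact ⟨(hint i).1.indicator measurableSet_Ici, (hint i).2.indicator measurableSet_Ici⟩

/-- This is the origin of `exponent`: a unit shot at `v` contributes `exponent` at `v` to the
functional, and shots superpose linearly. -/
lemma exponent_sum {P : Measure Ω} [IsProbabilityMeasure P] (X : Ω → ℝ)
    (hS : IsCountingProcess S) (ht : 0 ≤ t) (z s : ℝ) (ω : Ω) :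
    (1 - z) * (∫ u in (0 : ℝ)..t, residualTail P X t u * shotNoise r S B u ω) +
      s * shotNoise r S B t ω =
      ∑ i ∈ Finset.range (S t ω), exponent P X r t z s (epoch S i ω) * B i ω := by
  rw [integral_mul_shotNoise measurable_residualTail
    (fun u => by rw [abs_of_nonneg (residualTail_nonneg u)]; exact residualTail_le_one u) hS ht,
    shotNoise, Finset.mul_sum, Finset.mul_sum, ← Finset.sum_add_distrib]
  refine Finset.sum_congr rfl fun i _ => ?_
  simp only [exponent, residualTail]
  ring

/-- The residual tail may jump, but it enters only through an integral with variable lower limit. -/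
lemma continuous_exponent {P : Measure Ω} [IsProbabilityMeasure P] (X : Ω → ℝ) (r t z s : ℝ) :
    Continuous (exponent P X r t z s) := by
  have hint : ∀ a b, IntervalIntegrable
      (fun u => residualTail P X t u * Real.exp (-r * u)) volume a b := fun a b =>
    intervalIntegrable_of_abs_le_one measurable_residualTail
      (fun u => by rw [abs_of_nonneg (residualTail_nonneg u)]; exact residualTail_le_one u)
      (Continuous.intervalIntegrable (by fun_prop) a b)
  have hprim : Continuous fun v => ∫ u in v..t, residualTail P X t u * Real.exp (-r * u) := by
    simp_rw [fun v => intervalIntegral.integral_symm (μ := volume)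
      (f := fun u => residualTail P X t u * Real.exp (-r * u)) t v]
    exact (intervalIntegral.continuous_primitive hint t).neg
  have h1 : Continuous fun v : ℝ => (1 - z) * Real.exp (r * v) := by fun_prop
  have h2 : Continuous fun v : ℝ => s * Real.exp (-r * (t - v)) := by fun_prop
  exact (h1.mul hprim).add h2

end ShotNoise

/-! ### Laplace functional of the marked Poisson process -/

section LaplaceFunctional

variable {Ω : Type*} {mΩ : MeasurableSpace Ω} {P : Measure Ω} [IsProbabilityMeasure P]

/-- The Laplace functional of a Poisson process with i.i.d. marks, wherever it is finite. -/
lemma IsPoissonProcess.laplaceFunctional {ν : ℝ} (hν : 0 < ν) {S : ℝ → Ω → ℕ}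
    (hS : IsPoissonProcess P ν S) {B : ℕ → Ω → ℝ} (hB : ∀ i, Measurable (B i))
    (hB_indep : iIndepFun B P) (hB_ident : ∀ i, IdentDistrib (B i) (B 0) P P)
    (hSB : IndepFun (fun ω (u : ℝ) => S u ω) (fun ω (i : ℕ) => B i ω) P)
    {g : ℝ → ℝ} (hg : Continuous g) {t : ℝ} (ht : 0 ≤ t)
    (hint : Integrable (fun ω =>
      Real.exp (-∑ i ∈ Finset.range (S t ω), g (epoch S i ω) * B i ω)) P) :
    (∀ᵐ v ∂(volume.restrict (Ioc 0 t)), Integrable (fun ω => Real.exp (-g v * B 0 ω)) P) ∧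
    IntervalIntegrable (fun v => laplace P (B 0) (g v) - 1) volume 0 t ∧
    ∫ ω, Real.exp (-∑ i ∈ Finset.range (S t ω), g (epoch S i ω) * B i ω) ∂P =
      Real.exp (ν * ∫ v in (0 : ℝ)..t, (laplace P (B 0) (g v) - 1)) := by
  have hSc : IsCountingProcess S := hS.toIsCountingProcess
  have hB0 := hB 0
  -- Where `g` is negative the exponential may be unbounded with infinite mean. Truncation at `M`
  -- gives bounded continuous factors increasing to it.
  let b : ℕ → ℝ × ℝ → ℝ := fun M p => min (Real.exp (-g p.2 * p.1)) M
  have hbc : ∀ M, Continuous (b M) := fun M =>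
    (Real.continuous_exp.comp ((hg.comp continuous_snd).neg.mul continuous_fst)).min
      continuous_const
  have hb0 : ∀ M p, 0 ≤ b M p := fun M p => le_min (Real.exp_nonneg _) M.cast_nonneg
  have hbM : ∀ M p, b M p ≤ M := fun M p => min_le_right _ _
  have hb_mono : ∀ p, Monotone fun M => b M p := fun p M M' h =>
    min_le_min le_rfl (Nat.cast_le.2 h)
  have hb_lim : ∀ p : ℝ × ℝ, Tendsto (fun M => b M p) atTop (nhds (Real.exp (-g p.2 * p.1))) := by
    intro p
    refine tendsto_const_nhds.congr' ?_
    filter_upwards [eventually_ge_atTop ⌈Real.exp (-g p.2 * p.1)⌉₊] with M hM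
    exact (min_eq_left (Nat.ceil_le.1 hM)).symm
  let H : ℝ → ℝ≥0∞ := fun v => ∫⁻ ω, ENNReal.ofReal (Real.exp (-g v * B 0 ω)) ∂P
  let h : ℕ → ℝ → ℝ := fun M v => ∫ ω, b M (B 0 ω, v) ∂P
  have hb_meas : ∀ M v, Measurable fun ω => b M (B 0 ω, v) := fun M v =>
    (hbc M).measurable.comp (hB0.prodMk measurable_const)
  have hb_int : ∀ M v, Integrable (fun ω => b M (B 0 ω, v)) P := fun M v =>
    Integrable.of_bound (hb_meas M v).aestronglyMeasurable M (Eventually.of_forall fun ω => by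
      rw [Real.norm_of_nonneg (hb0 _ _)]
      exact hbM _ _)
  have hh0 : ∀ M v, 0 ≤ h M v := fun M v => integral_nonneg fun ω => hb0 _ _
  have hhM : ∀ M v, h M v ≤ M := fun M v => by
    have := integral_mono (hb_int M v) (integrable_const (M : ℝ)) fun ω => hbM M (B 0 ω, v)
    simpa using this
  have hhc : ∀ M, Continuous (h M) := fun M => by
    refine continuous_of_dominated (bound := fun _ => (M : ℝ))
      (fun v => (hb_meas M v).aestronglyMeasurable)
      (fun v => Eventually.of_forall fun ω => ?_) (integrable_const _)
      (Eventually.of_forall fun ω => (hbc M).comp (by fun_prop))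
    rw [Real.norm_of_nonneg (hb0 _ _)]
    exact hbM _ _
  have hh_lint : ∀ M v, ENNReal.ofReal (h M v) = ∫⁻ ω, ENNReal.ofReal (b M (B 0 ω, v)) ∂P :=
    fun M v => ofReal_integral_eq_lintegral_ofReal (hb_int M v)
      (Eventually.of_forall fun ω => hb0 _ _)
  have hh_mono : ∀ v, Monotone fun M => h M v := fun v M M' hMM =>
    integral_mono (hb_int M v) (hb_int M' v) fun ω => hb_mono _ hMM
  have hh_lim : ∀ v, Tendsto (fun M => ENNReal.ofReal (h M v)) atTop (nhds (H v)) := by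
    intro v
    simp_rw [hh_lint]
    exact lintegral_tendsto_of_tendsto_of_monotone
      (fun M => (hb_meas M v).ennreal_ofReal.aemeasurable)
      (Eventually.of_forall fun ω M M' hMM => ENNReal.ofReal_le_ofReal (hb_mono _ hMM))
      (Eventually.of_forall fun ω => ENNReal.tendsto_ofReal (hb_lim _))
  have hH_meas : Measurable H := measurable_of_tendsto_metrizable
    (fun M => (hhc M).measurable.ennreal_ofReal) (tendsto_pi_nhds.2 hh_lim)
  have hH_real : ∀ v, (H v).toReal = laplace P (B 0) (g v) := fun v => by
    rw [laplace, integral_eq_lintegral_of_nonneg_ae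
      (Eventually.of_forall fun ω => Real.exp_nonneg _) (by fun_prop)]
  let E : Ω → ℝ := fun ω => Real.exp (-∑ i ∈ Finset.range (S t ω), g (epoch S i ω) * B i ω)
  have htrunc : ∀ M : ℕ, ∫⁻ ω, ∏ i ∈ Finset.range (S t ω),
      ENNReal.ofReal (b M (B i ω, epoch S i ω)) ∂P =
      ENNReal.ofReal (Real.exp (ν * ∫ v in (0 : ℝ)..t, (h M v - 1))) := by
    intro M
    have hmix := lintegral_prod_epoch (m := MeasurableSpace.comap (fun ω (u : ℝ) => S u ω)
        inferInstance) (measurable_pi_lambda _ hSc.measurable).comap_le hSc hB hB_indep hB_ident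
      (fun u => (measurable_pi_apply u).comp (comap_measurable fun ω (u : ℝ) => S u ω))
      ((IndepFun_iff_Indep _ _ _).1 hSB.symm) (hbc M).measurable.ennreal_ofReal
      MeasurableSet.univ t
    simp only [Measure.restrict_univ, ← hh_lint] at hmix
    -- The rate is the constant `ν`, so the bound `M`, however large, has a finite dominating
    -- integral.
    rw [hmix, hS.hasMixedPoissonIncrements.lintegral_prod_epoch hSc measurable_const
      (fun _ _ => hν.le) ht (fun _ => intervalIntegrable_const) (M := M) (by simp)
      (hh0 M) (hhM M) fun u _ => (hhc M).continuousWithinAt]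
    simp only [lintegral_const, measure_univ, mul_one]
    rw [intervalIntegral.integral_mul_const, mul_comm]
  have hE_lim : Tendsto (fun M : ℕ =>
      ENNReal.ofReal (Real.exp (ν * ∫ v in (0 : ℝ)..t, (h M v - 1)))) atTop
      (nhds (∫⁻ ω, ENNReal.ofReal (E ω) ∂P)) := by
    simp_rw [← htrunc]
    refine lintegral_tendsto_of_tendsto_of_monotone (fun M => ?_)
      (Eventually.of_forall fun ω M M' hMM => Finset.prod_le_prod' fun i _ =>
        ENNReal.ofReal_le_ofReal (hb_mono _ hMM)) (Eventually.of_forall fun ω => ?_)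
    · simp_rw [fun ω => prod_range_epoch (N := S)
        (fun i e => ENNReal.ofReal (b M (B i ω, e))) t ω]
      exact (measurable_prod_range (hSc.measurable t) fun i => ((hbc M).measurable.comp
        ((hB i).prodMk (hSc.measurable_truncEpoch t i))).ennreal_ofReal).aemeasurable
    · have hprod : ENNReal.ofReal (E ω) = ∏ i ∈ Finset.range (S t ω),
          ENNReal.ofReal (Real.exp (-g (epoch S i ω) * B i ω)) := by
        rw [← ENNReal.ofReal_prod_of_nonneg fun i _ => Real.exp_nonneg _, ← Real.exp_sum]
        simp only [E, neg_mul, Finset.sum_neg_distrib]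
      rw [hprod]
      exact ENNReal.tendsto_finsetProd_of_ne_top _
        (fun i _ => ENNReal.tendsto_ofReal (hb_lim (B i ω, epoch S i ω)))
        fun i _ => ENNReal.ofReal_ne_top
  have hE_eq : ENNReal.ofReal (∫ ω, E ω ∂P) = ∫⁻ ω, ENNReal.ofReal (E ω) ∂P :=
    ofReal_integral_eq_lintegral_ofReal hint (Eventually.of_forall fun ω => Real.exp_nonneg _)
  rw [← hE_eq] at hE_lim
  have hE_pos : 0 < ∫ ω, E ω ∂P := integral_exp_pos hint
  have hhi : ∀ M, IntervalIntegrable (h M) volume 0 t := fun M => (hhc M).intervalIntegrable _ _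
  -- The truncated values increase to `E[E]`, so each is at most it; taking logarithms and dividing
  -- by `ν > 0` bounds `∫ h M` uniformly in `M`. This is what makes `H` integrable.
  have hh_bound : ∀ M : ℕ, ∫ v in (0 : ℝ)..t, h M v ≤ Real.log (∫ ω, E ω ∂P) / ν + t := by
    intro M
    have hmonoM : Monotone fun M : ℕ =>
        ENNReal.ofReal (Real.exp (ν * ∫ v in (0 : ℝ)..t, (h M v - 1))) := fun M M' hMM => by
      refine ENNReal.ofReal_le_ofReal (Real.exp_le_exp.2 (mul_le_mul_of_nonneg_left ?_ hν.le))
      exact intervalIntegral.integral_mono_on ht ((hhi M).sub intervalIntegrable_const)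
        ((hhi M').sub intervalIntegrable_const) fun v _ => sub_le_sub_right (hh_mono v hMM) 1
    have hle := hmonoM.ge_of_tendsto hE_lim M
    rw [ENNReal.ofReal_le_ofReal_iff hE_pos.le, ← Real.le_log_iff_exp_le hE_pos,
      intervalIntegral.integral_sub (hhi M) intervalIntegrable_const] at hle
    simp only [intervalIntegral.integral_const, sub_zero, smul_eq_mul, mul_one] at hle
    rw [← sub_le_iff_le_add, le_div_iff₀ hν]
    linarith
  have hh_set : ∀ M, ENNReal.ofReal (∫ v in (0 : ℝ)..t, h M v) =
      ∫⁻ v in Ioc 0 t, ENNReal.ofReal (h M v) := fun M => by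
    rw [intervalIntegral.integral_of_le ht]
    exact ofReal_integral_eq_lintegral_ofReal (hhi M).1 (Eventually.of_forall (hh0 M))
  have hH_lim : Tendsto (fun M => ∫⁻ v in Ioc 0 t, ENNReal.ofReal (h M v)) atTop
      (nhds (∫⁻ v in Ioc 0 t, H v)) :=
    lintegral_tendsto_of_tendsto_of_monotone
      (fun M => (hhc M).measurable.ennreal_ofReal.aemeasurable)
      (Eventually.of_forall fun v M M' hMM => ENNReal.ofReal_le_ofReal (hh_mono v hMM))
      (Eventually.of_forall hh_lim)
  have hH_fin : ∫⁻ v in Ioc 0 t, H v ≠ ∞ := by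
    refine ne_top_of_le_ne_top
      (b := ENNReal.ofReal (Real.log (∫ ω, E ω ∂P) / ν + t)) ENNReal.ofReal_ne_top
      (le_of_tendsto' hH_lim fun M => ?_)
    rw [← hh_set]
    exact ENNReal.ofReal_le_ofReal (hh_bound M)
  have hlap : Integrable (fun v => laplace P (B 0) (g v)) (volume.restrict (Ioc 0 t)) := by
    simp_rw [← hH_real]
    exact integrable_toReal_of_lintegral_ne_top hH_meas.aemeasurable hH_fin
  have hlapi : IntervalIntegrable (fun v => laplace P (B 0) (g v)) volume 0 t :=
    (intervalIntegrable_iff_integrableOn_Ioc_of_le ht).2 hlap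
  have hH_ae := ae_lt_top hH_meas hH_fin
  refine ⟨?_, hlapi.sub intervalIntegrable_const, ?_⟩
  · filter_upwards [hH_ae] with v hv
    refine ⟨by fun_prop, ?_⟩
    rw [hasFiniteIntegral_iff_ofReal (Eventually.of_forall fun ω => Real.exp_nonneg _)]
    exact hv
  · have hH_int : ∫ v in (0 : ℝ)..t, laplace P (B 0) (g v) =
        (∫⁻ v in Ioc 0 t, H v).toReal := by
      rw [intervalIntegral.integral_of_le ht, ← integral_toReal hH_meas.aemeasurable hH_ae]
      simp_rw [hH_real]
    have hh_int : ∀ M, (∫⁻ v in Ioc 0 t, ENNReal.ofReal (h M v)).toReal =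
        ∫ v in (0 : ℝ)..t, h M v := fun M => by
      rw [← hh_set, ENNReal.toReal_ofReal
        (intervalIntegral.integral_nonneg ht fun v _ => hh0 M v)]
    have hlim : Tendsto (fun M => ∫ v in (0 : ℝ)..t, h M v) atTop
        (nhds (∫ v in (0 : ℝ)..t, laplace P (B 0) (g v))) := by
      rw [hH_int]
      exact ((ENNReal.tendsto_toReal hH_fin).comp hH_lim).congr hh_int
    have hlim' : Tendsto (fun M : ℕ =>
        ENNReal.ofReal (Real.exp (ν * ∫ v in (0 : ℝ)..t, (h M v - 1)))) atTop
        (nhds (ENNReal.ofReal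
          (Real.exp (ν * ∫ v in (0 : ℝ)..t, (laplace P (B 0) (g v) - 1))))) := by
      refine ENNReal.tendsto_ofReal ((Real.continuous_exp.tendsto _).comp (Tendsto.const_mul _ ?_))
      rw [intervalIntegral.integral_sub hlapi intervalIntegrable_const]
      simp_rw [fun M => intervalIntegral.integral_sub (hhi M)
        (intervalIntegrable_const (c := (1 : ℝ)))]
      exact hlim.sub_const _
    exact (ENNReal.ofReal_eq_ofReal_iff hE_pos.le (Real.exp_nonneg _)).1
      (tendsto_nhds_unique hE_lim hlim')

end LaplaceFunctional

end ShotNoiseQueue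

/-! ### Assembly of the theorem -/

theorem mainTheorem2 {Ω : Type*} [MeasurableSpace Ω] (P : Measure Ω) [IsProbabilityMeasure P]
    (ν r : ℝ) (hν : 0 < ν) (hr : 0 < r)
    -- the Poisson process of shots and the i.i.d. shot sizes
    (S : ℝ → Ω → ℕ) (hS : ShotNoiseQueue.IsPoissonProcess P ν S)
    (B : ℕ → Ω → ℝ) (hB_meas : ∀ i, Measurable (B i)) (hB_nonneg : ∀ i ω, 0 ≤ B i ω)
    (hB_indep : iIndepFun B P) (hB_ident : ∀ i, IdentDistrib (B i) (B 0) P P)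
    (hSB : IndepFun (fun ω (u : ℝ) => S u ω) (fun ω (i : ℕ) => B i ω) P)
    -- the shot-noise rate
    (L : ℝ → Ω → ℝ) (hL : L = ShotNoiseQueue.shotNoise r S B)
    -- the arrival process, a Cox process driven by the shot noise
    (A : ℝ → Ω → ℕ) (hA : ShotNoiseQueue.IsCoxProcess P L A)
    -- the i.i.d. service requirements
    (J : ℕ → Ω → ℝ) (hJ_meas : ∀ i, Measurable (J i)) (hJ_nonneg : ∀ i ω, 0 ≤ J i ω)
    (hJ_indep : iIndepFun J P) (hJ_ident : ∀ i, IdentDistrib (J i) (J 0) P P)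
    (hJLA : IndepFun (fun ω (i : ℕ) => J i ω)
      (fun ω => ((fun u : ℝ => L u ω), (fun u : ℝ => A u ω))) P)
    -- the number of jobs in the system
    (N : ℝ → Ω → ℕ) (hN : N = ShotNoiseQueue.numJobs A J)
    (t : ℝ) (ht : 0 ≤ t) :
    -- `N t` is mixed Poisson: conditionally on the rate process, it has a Poisson distribution
    (∀ k : ℕ, P⟦{ω | N t ω = k} | ShotNoiseQueue.sigmaAlgebra L⟧ =ᵐ[P] fun ω =>
      (poissonMeasure (∫ u in (0 : ℝ)..t,
        P.real {ω' | t - u < J 0 ω'} * L u ω).toNNReal).real {k}) ∧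
    -- the joint transform exists for `|z| ≤ 1` and `s ≥ 0`
    (∀ z s : ℝ, |z| ≤ 1 → 0 ≤ s →
      Integrable (fun ω => z ^ N t ω * Real.exp (-s * L t ω)) P) ∧
    -- wherever it exists, it is given by the formula, all of whose ingredients exist
    (∀ z s : ℝ, Integrable (fun ω => z ^ N t ω * Real.exp (-s * L t ω)) P →
      (∀ᵐ v ∂(volume.restrict (Ioc 0 t)), Integrable
        (fun ω => Real.exp (-ShotNoiseQueue.exponent P (J 0) r t z s v * B 0 ω)) P) ∧
      IntervalIntegrable (fun v =>
        ShotNoiseQueue.laplace P (B 0) (ShotNoiseQueue.exponent P (J 0) r t z s v) - 1)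
        volume 0 t ∧
      0 < ShotNoiseQueue.jointTransform P N L t z s ∧
      Real.log (ShotNoiseQueue.jointTransform P N L t z s) =
        ν * ∫ v in (0 : ℝ)..t,
          (ShotNoiseQueue.laplace P (B 0) (ShotNoiseQueue.exponent P (J 0) r t z s v) - 1)) := by
  subst hL hN
  have hSc : ShotNoiseQueue.IsCountingProcess S := hS.toIsCountingProcess
  have hLm := ShotNoiseQueue.measurable_shotNoise (r := r) hSc hB_meas
  have hL0 := ShotNoiseQueue.shotNoise_nonneg (r := r) (S := S) hB_nonneg
  have hLc := ShotNoiseQueue.shotNoise_rightCont (r := r) hSc B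
  have hm := ShotNoiseQueue.sigmaAlgebra_le hLm
  have hLσ := ShotNoiseQueue.measurable_sigmaAlgebra (ShotNoiseQueue.shotNoise r S B)
  have hN := ShotNoiseQueue.measurable_numJobs hA.toIsCountingProcess hJ_meas t
  have hlaw := hA.hasMixedPoissonLaw_numJobs hLm hL0 hLc ht
    (ShotNoiseQueue.intervalIntegrable_shotNoise hr.le hSc hB_meas hB_nonneg ht)
    hJ_meas hJ_indep hJ_ident hJLA
  set x : Ω → ℝ := fun ω => ∫ u in (0 : ℝ)..t,
    ShotNoiseQueue.residualTail P (J 0) t u * ShotNoiseQueue.shotNoise r S B u ω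
  have hx0 : ∀ ω, 0 ≤ x ω := fun ω => intervalIntegral.integral_nonneg ht fun u _ =>
    mul_nonneg (ShotNoiseQueue.residualTail_nonneg u) (hL0 u ω)
  have hxσ : Measurable[ShotNoiseQueue.sigmaAlgebra (ShotNoiseQueue.shotNoise r S B)] x :=
    ShotNoiseQueue.measurable_intervalIntegral
      (mΩ := ShotNoiseQueue.sigmaAlgebra (ShotNoiseQueue.shotNoise r S B))
      ((ShotNoiseQueue.measurable_residualTail.comp measurable_fst).mul
        (ShotNoiseQueue.measurable_uncurry_of_rightCont hLσ hLc)) 0 t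
  have hx : Measurable x := hxσ.mono hm le_rfl
  refine ⟨fun k => hlaw.condExp_ae_eq hm hN hxσ k, fun z s hz hs => ?_, fun z s hint => ?_⟩
  · have hLt := hLm t
    refine Integrable.of_bound (Measurable.aestronglyMeasurable (by fun_prop)) 1
      (Eventually.of_forall fun ω => ?_)
    rw [norm_mul, norm_pow, Real.norm_eq_abs, Real.norm_of_nonneg (Real.exp_nonneg _)]
    refine mul_le_one₀ (pow_le_one₀ (abs_nonneg z) hz) (Real.exp_nonneg _)
      (Real.exp_le_one_iff.2 ?_)
    nlinarith [hL0 t ω]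
  · have hyσ : Measurable[ShotNoiseQueue.sigmaAlgebra (ShotNoiseQueue.shotNoise r S B)]
        fun ω => Real.exp (-s * ShotNoiseQueue.shotNoise r S B t ω) :=
      Real.measurable_exp.comp ((hLσ t).const_mul (-s))
    have hy0 : ∀ ω, 0 ≤ Real.exp (-s * ShotNoiseQueue.shotNoise r S B t ω) :=
      fun ω => Real.exp_nonneg _
    have hy := hyσ.mono hm le_rfl
    have hexp : ∀ ω, Real.exp ((z - 1) * x ω) *
        Real.exp (-s * ShotNoiseQueue.shotNoise r S B t ω) =
        Real.exp (-∑ i ∈ Finset.range (S t ω), ShotNoiseQueue.exponent P (J 0) r t z s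
          (ShotNoiseQueue.epoch S i ω) * B i ω) := fun ω => by
      rw [← ShotNoiseQueue.exponent_sum (J 0) hSc ht z s ω, ← Real.exp_add]
      congr 1
      simp only [x]
      ring
    -- Integrability is known with `|z|` in place of `z`; since `x` is nonnegative and `z ≤ |z|`,
    -- that version dominates.
    have hint' : Integrable (fun ω => Real.exp ((z - 1) * x ω) *
        Real.exp (-s * ShotNoiseQueue.shotNoise r S B t ω)) P := by
      refine (hlaw.integrable_exp hm hN hx hx0 hyσ hy0 hint).mono'
        (Measurable.aestronglyMeasurable (by fun_prop)) (Eventually.of_forall fun ω => ?_)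
      rw [Real.norm_of_nonneg (by positivity)]
      gcongr
      · exact hx0 ω
      · exact le_abs_self z
    have hξ := hlaw.integral_pow_mul hm hN hx hx0 hyσ hy0 hint
    simp_rw [hexp] at hint' hξ
    obtain ⟨h1, h2, h3⟩ := hS.laplaceFunctional hν hB_meas hB_indep hB_ident hSB
      (ShotNoiseQueue.continuous_exponent (J 0) r t z s) ht hint'
    refine ⟨h1, h2, ?_⟩
    rw [ShotNoiseQueue.jointTransform, hξ, h3]
    exact ⟨Real.exp_pos _, Real.log_exp _⟩
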